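/- **Theorem 5.2 (permutability with spectral transforms).** *Setting.* Let $r\ge 1$, $n\ge r+2$, let $\mathbb R^{m}_{s}$ be $\mathbb R^m$ with the scalar product of signature $(m-s,s)$, and let $Q^n_r$ be the projective light cone of $\mathbb R^{n+2}_{r+1}$. Let $U\subset\mathbb R^2$ be open with coordinates $(u,v)$, and let $\sigma,\varepsilon\in\{1,-1\}$. A *canonical lift* of a map $y$ from $U$ to a projective light cone with respect to the asymptotic coordinate $(u,\sigma v)$ is a smooth lift $Y$ into the light cone, $y=[Y]$, with $\langle Y_u,Y_u\rangle=\langle Y_v,Y_v\rangle=0$ and $\langle Y_u,Y_v\rangle=\sigma/2$. Put $V=\mathrm{Span}\{Y,Y_u,Y_v,Y_{uv}\}$; $V^\perp$ is the conformal normal bundle, and the normal connection $D_u,D_v$ on it is the orthogonal projection of $\partial_u,\partial_v$. The Hopf differentials $\kappa_1,\kappa_2\in\Gamma(V^\perp)$ and the Schwarzians $s_1,s_2$ are defined by $Y_{uu}=-\frac{s_1}{2}Y+\kappa_1$ and $Y_{vv}=-\frac{s_2}{2}Y+\kappa_2$. The timelike surface $y$ is $(\varepsilon)$-*isothermic* with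 adapted coordinate $(u,\sigma v)$ if it has a canonical lift with $\kappa_1=\varepsilon\kappa_2$ on $U$. *Spectral transform.* Let $y,y^{\tilde c}$ be timelike $(\varepsilon)$-isothermic surfaces with the same adapted coordinate on $U$, and let $\tilde c\in\mathbb R$. Then $y^{\tilde c}$ is a $\tilde c$-parameter spectral transform of $y$ (in this coordinate) if for some canonical lifts $s_1^{\tilde c}=s_1+\tilde c$, $s_2^{\tilde c}=s_2+\varepsilon\tilde c$, and there is a smooth isometric isomorphism between the conformal normal bundles of $y$ and $y^{\tilde c}$ which intertwines the normal connections and maps $\kappa_1,\kappa_2$ to $\kappa_1^{\tilde c},\kappa_2^{\tilde c}$. *Polar surfaces.* For $c\in\mathbb R$, a $c$-polar surface of $y$ is a smooth section $\psi$ of $V^\perp$ over $U$ with $D_u\psi=D_v\psi=0$ and $\langle\psi,\psi\rangle=c$. Let $M_0\subset U$ be the set of points at which the metric $\langle d\psi,d\psi\rangle$ is non-degenerate; $\psi$ is *non-degenerate* if $M_0$ is dense in $U$. On $M_0$, $\psi$ is regarded as a surface in a projective light cone: as $[\psi]$ in that of $\mathbb R^{n+2}_{r+1}$ if $c=0$;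 as $[(\psi,\sqrt c)]$ in that of $\mathbb R^{n+3}_{r+2}$ if $c>0$; and as $[(\sqrt{-c},\psi)]$ in that of $\mathbb R^{n+3}_{r+1}$ if $c<0$. For $c\neq0$ this is the conformal embedding of the space form $\{\langle x,x\rangle=c\}$ of curvature $1/c$. *Claim.* Let $y:U\to Q^n_r$ be a timelike $(\varepsilon)$-isothermic surface with adapted coordinate $(u,v)$, and let $y^{\tilde c}$ be a $\tilde c$-parameter spectral transform of $y$. Then for every $c\in\mathbb R$ and every non-degenerate $c$-polar surface $\psi$ of $y$ there is a $c$-polar surface $\psi^{\tilde c}$ of $y^{\tilde c}$ such that on $M_0$ the surface $\psi^{\tilde c}$ is a $\tilde c$-parameter spectral transform of $\psi$, both being timelike $(\varepsilon)$-isothermic with adapted coordinate $(u,\varepsilon v)$; that is, the square $$\begin{array}{ccc} y&\longrightarrow& y^{\tilde c}\\ \downarrow&&\downarrow\\ \psi&\longrightarrow&\psi^{\tilde c}\end{array}$$ of spectral transforms (horizontal) and polar transforms (vertical) commutes. -/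

import Mathlib

open scoped ContDiff

noncomputable section

/-- The scalar product of `ℝ^m_s`: the first `m - s` coordinates are positive, the last `s`
coordinates are negative. -/
def pseudoForm (m s : ℕ) : LinearMap.BilinForm ℝ (Fin m → ℝ) :=
  LinearMap.mk₂ ℝ (fun x y => ∑ i : Fin m, (if i.val + s < m then (1 : ℝ) else -1) * (x i * y i))
    (fun x x' y => by
      rw [← Finset.sum_add_distrib]
      exact Finset.sum_congr rfl fun i _ => by simp only [Pi.add_apply]; ring)
    (fun a x y => by
      rw [Finset.smul_sum]
      exact Finset.sum_congr rfl fun i _ => by simp only [Pi.smul_apply, smul_eq_mul]; ring)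
    (fun x y y' => by
      rw [← Finset.sum_add_distrib]
      exact Finset.sum_congr rfl fun i _ => by simp only [Pi.add_apply]; ring)
    (fun a x y => by
      rw [Finset.smul_sum]
      exact Finset.sum_congr rfl fun i _ => by simp only [Pi.smul_apply, smul_eq_mul]; ring)

section Surfaces

variable {E : Type*} [NormedAddCommGroup E] [NormedSpace ℝ E]

/-- Partial derivative in the first coordinate `u`. -/
def partialU (f : ℝ × ℝ → E) (p : ℝ × ℝ) : E := fderiv ℝ f p (1, 0)

/-- Partial derivative in the second coordinate `v`. -/
def partialV (f : ℝ × ℝ → E) (p : ℝ × ℝ) : E := fderiv ℝ f p (0, 1)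

/-- On `U`, the vector function `X` is nowhere zero and represents the map `q` into the
projective space of `E`, that is `q = [X]`. -/
def IsLift (U : Set (ℝ × ℝ)) (X : ℝ × ℝ → E) (q : ℝ × ℝ → Projectivization ℝ E) : Prop :=
  ∀ p ∈ U, ∃ h : X p ≠ 0, q p = Projectivization.mk ℝ (X p) h

/-- `Y` is a canonical lift, over the coordinate domain `U`, of the surface `q = [Y]` in the
projective light cone of `(E, B)`, with respect to the asymptotic coordinate `(u, σ v)`, where
`σ` is `1` or `-1`: it takes values in the light cone and its induced metric is
`σ / 2 (du ⊗ dv + dv ⊗ du)`. In particular `q` is a timelike immersion. -/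
structure IsCanonicalLift (B : LinearMap.BilinForm ℝ E) (σ : ℝ) (U : Set (ℝ × ℝ))
    (Y : ℝ × ℝ → E) (q : ℝ × ℝ → Projectivization ℝ E) : Prop where
  smooth : ContDiffOn ℝ ∞ Y U
  lift : IsLift U Y q
  null : ∀ p ∈ U, B (Y p) (Y p) = 0
  metric_uu : ∀ p ∈ U, B (partialU Y p) (partialU Y p) = 0
  metric_vv : ∀ p ∈ U, B (partialV Y p) (partialV Y p) = 0
  metric_uv : ∀ p ∈ U, B (partialU Y p) (partialV Y p) = σ / 2

/-- The fibre `Span {Y, Y_u, Y_v, Y_uv}` of the conformal tangent bundle. -/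
def confTangent (Y : ℝ × ℝ → E) (p : ℝ × ℝ) : Submodule ℝ E :=
  Submodule.span ℝ {Y p, partialU Y p, partialV Y p, partialV (partialU Y) p}

/-- The fibre of the conformal normal bundle, the orthogonal complement of the conformal tangent
bundle. -/
def confNormal (B : LinearMap.BilinForm ℝ E) (Y : ℝ × ℝ → E) (p : ℝ × ℝ) : Submodule ℝ E :=
  B.orthogonal (confTangent Y p)

/-- The vector `N` of the moving frame `Y, Y_u, Y_v, N` of the conformal tangent bundle: it is
orthogonal to `Y_u, Y_v`, null, and `⟨Y, N⟩ = -1`. (The number `⟨Y_uv, Y_uv⟩` equals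
`⟨κ₁, κ₂⟩`.) -/
def frameN (B : LinearMap.BilinForm ℝ E) (σ : ℝ) (Y : ℝ × ℝ → E) (p : ℝ × ℝ) : E :=
  (2 * σ) • partialV (partialU Y) p
    + (2 * B (partialV (partialU Y) p) (partialV (partialU Y) p)) • Y p

/-- The orthogonal projection of the ambient space onto the fibre of the conformal normal bundle,
written in the frame `Y, Y_u, Y_v, N`. -/
def normalProj (B : LinearMap.BilinForm ℝ E) (σ : ℝ) (Y : ℝ × ℝ → E) (p : ℝ × ℝ) (x : E) : E :=
  x + B x (frameN B σ Y p) • Y p + B x (Y p) • frameN B σ Y p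
    - (2 * σ * B x (partialV Y p)) • partialU Y p - (2 * σ * B x (partialU Y p)) • partialV Y p

/-- The conformal Hopf differential `κ₁`, the normal part of `Y_uu`. -/
def hopfU (B : LinearMap.BilinForm ℝ E) (σ : ℝ) (Y : ℝ × ℝ → E) (p : ℝ × ℝ) : E :=
  normalProj B σ Y p (partialU (partialU Y) p)

/-- The conformal Hopf differential `κ₂`, the normal part of `Y_vv`. -/
def hopfV (B : LinearMap.BilinForm ℝ E) (σ : ℝ) (Y : ℝ × ℝ → E) (p : ℝ × ℝ) : E :=
  normalProj B σ Y p (partialV (partialV Y) p)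

/-- The Schwarzian `s₁`, determined by `Y_uu = -(s₁ / 2) Y + κ₁` and `⟨Y, N⟩ = -1`. -/
def schwarzU (B : LinearMap.BilinForm ℝ E) (σ : ℝ) (Y : ℝ × ℝ → E) (p : ℝ × ℝ) : ℝ :=
  2 * B (partialU (partialU Y) p) (frameN B σ Y p)

/-- The Schwarzian `s₂`, determined by `Y_vv = -(s₂ / 2) Y + κ₂` and `⟨Y, N⟩ = -1`. -/
def schwarzV (B : LinearMap.BilinForm ℝ E) (σ : ℝ) (Y : ℝ × ℝ → E) (p : ℝ × ℝ) : ℝ :=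
  2 * B (partialV (partialV Y) p) (frameN B σ Y p)

/-- `ξ` is a smooth section over `W` of the conformal normal bundle. -/
def IsNormalSection (B : LinearMap.BilinForm ℝ E) (Y : ℝ × ℝ → E) (W : Set (ℝ × ℝ))
    (ξ : ℝ × ℝ → E) : Prop :=
  ContDiffOn ℝ ∞ ξ W ∧ ∀ p ∈ W, ξ p ∈ confNormal B Y p

/-- The normal connection `D_u ξ`. -/
def normalDU (B : LinearMap.BilinForm ℝ E) (σ : ℝ) (Y ξ : ℝ × ℝ → E) (p : ℝ × ℝ) : E :=
  normalProj B σ Y p (partialU ξ p)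

/-- The normal connection `D_v ξ`. -/
def normalDV (B : LinearMap.BilinForm ℝ E) (σ : ℝ) (Y ξ : ℝ × ℝ → E) (p : ℝ × ℝ) : E :=
  normalProj B σ Y p (partialV ξ p)

/-- `Y` has an adapted coordinate: `κ₁ = ε κ₂` on `U`. -/
def IsIsothermicOn (B : LinearMap.BilinForm ℝ E) (σ ε : ℝ) (U : Set (ℝ × ℝ))
    (Y : ℝ × ℝ → E) : Prop :=
  ∀ p ∈ U, hopfU B σ Y p = ε • hopfV B σ Y p

/-- `τ` is an isomorphism over `U` from the conformal normal bundle of `Y` onto that of `Y'` which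
preserves the metric and smoothness of sections and intertwines the normal connections. -/
structure IsNormalBundleIso (B : LinearMap.BilinForm ℝ E) (σ : ℝ) (U : Set (ℝ × ℝ))
    (Y Y' : ℝ × ℝ → E) (τ : ℝ × ℝ → E →ₗ[ℝ] E) : Prop where
  bij : ∀ p ∈ U, Set.BijOn (τ p) (confNormal B Y p) (confNormal B Y' p)
  isometric : ∀ p ∈ U, ∀ x ∈ confNormal B Y p, ∀ z ∈ confNormal B Y p,
    B (τ p x) (τ p z) = B x z
  smooth : ∀ W : Set (ℝ × ℝ), IsOpen W → W ⊆ U → ∀ ξ : ℝ × ℝ → E, IsNormalSection B Y W ξ →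
    ContDiffOn ℝ ∞ (fun p => τ p (ξ p)) W
  connU : ∀ W : Set (ℝ × ℝ), IsOpen W → W ⊆ U → ∀ ξ : ℝ × ℝ → E, IsNormalSection B Y W ξ →
    ∀ p ∈ W, normalDU B σ Y' (fun q => τ q (ξ q)) p = τ p (normalDU B σ Y ξ p)
  connV : ∀ W : Set (ℝ × ℝ), IsOpen W → W ⊆ U → ∀ ξ : ℝ × ℝ → E, IsNormalSection B Y W ξ →
    ∀ p ∈ W, normalDV B σ Y' (fun q => τ q (ξ q)) p = τ p (normalDV B σ Y ξ p)

/-- The surface `y'` is a `c̃`-parameter spectral transform of the surface `y`, both being timelike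
`(ε)`-isothermic in the projective light cone of `(E, B)` with adapted coordinate `(u, σ v)`
on `U`: the Schwarzians are shifted to `s₁ + c̃` and `s₂ + ε c̃`, and all other invariants (normal
bundle with metric and connection, Hopf differentials) are kept. -/
def IsSpectralTransform (B : LinearMap.BilinForm ℝ E) (σ ε ctilde : ℝ) (U : Set (ℝ × ℝ))
    (y y' : ℝ × ℝ → Projectivization ℝ E) : Prop :=
  ∃ Y Y' : ℝ × ℝ → E,
    IsCanonicalLift B σ U Y y ∧ IsCanonicalLift B σ U Y' y' ∧
    IsIsothermicOn B σ ε U Y ∧ IsIsothermicOn B σ ε U Y' ∧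
    (∀ p ∈ U, schwarzU B σ Y' p = schwarzU B σ Y p + ctilde) ∧
    (∀ p ∈ U, schwarzV B σ Y' p = schwarzV B σ Y p + ε * ctilde) ∧
    ∃ τ : ℝ × ℝ → E →ₗ[ℝ] E, IsNormalBundleIso B σ U Y Y' τ ∧
      (∀ p ∈ U, τ p (hopfU B σ Y p) = hopfU B σ Y' p) ∧
      (∀ p ∈ U, τ p (hopfV B σ Y p) = hopfV B σ Y' p)

/-- `ψ` is a `c`-polar surface of the surface `y`: a parallel section of length `c` of the
conformal normal bundle. (Canonical lifts of `y` differ by locally constant signs, on which nothing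
here depends.) -/
def IsPolar (B : LinearMap.BilinForm ℝ E) (U : Set (ℝ × ℝ)) (c : ℝ)
    (y : ℝ × ℝ → Projectivization ℝ E) (ψ : ℝ × ℝ → E) : Prop :=
  ∃ Y : ℝ × ℝ → E, IsCanonicalLift B 1 U Y y ∧ IsNormalSection B Y U ψ ∧
    (∀ p ∈ U, normalDU B 1 Y ψ p = 0) ∧ (∀ p ∈ U, normalDV B 1 Y ψ p = 0) ∧
    ∀ p ∈ U, B (ψ p) (ψ p) = c

/-- The set of points of `U` at which the metric induced by `ψ` is non-degenerate. -/
def regularSet (B : LinearMap.BilinForm ℝ E) (U : Set (ℝ × ℝ)) (ψ : ℝ × ℝ → E) : Set (ℝ × ℝ) :=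
  {p ∈ U | B (partialU ψ p) (partialU ψ p) * B (partialV ψ p) (partialV ψ p)
      - B (partialU ψ p) (partialV ψ p) * B (partialU ψ p) (partialV ψ p) ≠ 0}

/-- `ψ` is non-degenerate: it is so on a dense subset of `U`. -/
def IsNondegenerate (B : LinearMap.BilinForm ℝ E) (U : Set (ℝ × ℝ)) (ψ : ℝ × ℝ → E) : Prop :=
  U ⊆ closure (regularSet B U ψ)

/-- The surface `[X']` is a `c̃`-parameter spectral transform of `[X]`, where the lifts `X`, `X'`
need not be canonical. -/
def IsSpectralTransformOfLifts (B : LinearMap.BilinForm ℝ E) (σ ε ctilde : ℝ) (U : Set (ℝ × ℝ))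
    (X X' : ℝ × ℝ → E) : Prop :=
  ∃ q q' : ℝ × ℝ → Projectivization ℝ E,
    IsLift U X q ∧ IsLift U X' q' ∧ IsSpectralTransform B σ ε ctilde U q q'

end Surfaces

/-- For surfaces `ψ, ψ'` in the quadric `⟨x, x⟩ = c` of `ℝ^m_s`: `ψ'` is a `c̃`-parameter spectral
transform of `ψ`. For `c = 0` these are surfaces `[ψ], [ψ']` in the projective light cone of
`ℝ^m_s`. For `c ≠ 0` the quadric is a space form of curvature `1 / c`, conformally embedded in a
projective light cone by `x ↦ [(x, √c)]`, with an additional negative coordinate, if `c > 0`, and by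
`x ↦ [(√(-c), x)]`, with an additional positive coordinate, if `c < 0`. -/
def IsQuadricSpectralTransform (m s : ℕ) (c σ ε ctilde : ℝ) (U : Set (ℝ × ℝ))
    (ψ ψ' : ℝ × ℝ → Fin m → ℝ) : Prop :=
  (c = 0 → IsSpectralTransformOfLifts (pseudoForm m s) σ ε ctilde U ψ ψ') ∧
  (0 < c → IsSpectralTransformOfLifts (pseudoForm (m + 1) (s + 1)) σ ε ctilde U
    (fun p => (Fin.snoc (ψ p) (Real.sqrt c) : Fin (m + 1) → ℝ))
    (fun p => (Fin.snoc (ψ' p) (Real.sqrt c) : Fin (m + 1) → ℝ))) ∧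
  (c < 0 → IsSpectralTransformOfLifts (pseudoForm (m + 1) s) σ ε ctilde U
    (fun p => (Fin.cons (Real.sqrt (-c)) (ψ p) : Fin (m + 1) → ℝ))
    (fun p => (Fin.cons (Real.sqrt (-c)) (ψ' p) : Fin (m + 1) → ℝ)))

end

/-! The spectral transform is realised by a gauge transformation of the ambient space. Let T_p send
the frame Y, Y_u, Y_v, N of y to the frame of the transform and agree with τ on the normal bundle.
The two frames have the same Gram matrix and τ is isometric, so T_p is an isometry. In the structure
equations every coefficient agrees except the Schwarzians, which enter only Y_uu, Y_vv, N_u and N_v.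
Hence T commutes with differentiation up to a term of rank two: (Tξ)_u = T ξ_u + c̃ (⟨ξ, Y⟩ Y'_v -
⟨ξ, Y_v⟩ Y'), and likewise in v with constant ε c̃ (`IsHopfIso.dirDeriv_gaugeMap`). No integration
is involved, since T is defined pointwise.

Let ψ be a polar surface and k = ⟨ψ, κ₂⟩. The Weingarten equations give ψ_u = 2ε(k_v Y - k Y_v) and
ψ_v = 2(k_u Y - k Y_u). So ψ is regular exactly where k ≠ 0, and there X = (ψ + e)/(2k) is a
canonical lift with sign ε, where e is the constant vector that moves the quadric into a light cone.
It is isothermic because ψ_uu - εψ_vv is tangent to ψ (`IsPolarPair.isPolarLift`,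
`IsPolarPair.deriv_uu_sub`).

These formulas make X and X_u orthogonal to Y and Y_v, and X and X_v orthogonal to Y and Y_u. The
correction term therefore vanishes for X_u, X_v, X_uu, X_vv, and TX is again a canonical lift. Only
the mixed derivative changes, by a multiple of Y', and this shifts the Schwarzians by c̃ and εc̃.
The map T followed by the normal projection along TX is the required bundle isomorphism: Y_v lies in
the span of Y, X, X_u, so on sections normal to X the correction is tangent to TX and is projected
away (`IsPolarLift.conn_map`, `IsPolarLift.isSpectralTransform`). Since T = τ on normal vectors, the
transformed polar surface is τψ, and T extended by the identity fixes e. -/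

/-! ### Directional derivatives of smooth maps on open subsets of the plane -/

section Calculus

variable {E : Type*} [NormedAddCommGroup E] [NormedSpace ℝ E]

/-- The derivative of `f` in the direction `w`. -/
noncomputable def dirDeriv (w : ℝ × ℝ) (f : ℝ × ℝ → E) (p : ℝ × ℝ) : E := fderiv ℝ f p w

theorem partialU_eq (f : ℝ × ℝ → E) : partialU f = dirDeriv (1, 0) f := rfl

theorem partialV_eq (f : ℝ × ℝ → E) : partialV f = dirDeriv (0, 1) f := rfl

variable {U : Set (ℝ × ℝ)} {w z p : ℝ × ℝ} {f g : ℝ × ℝ → E}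

theorem ContDiffOn.differentiableAt_of_isOpen (hU : IsOpen U) (hf : ContDiffOn ℝ ∞ f U)
    (hp : p ∈ U) : DifferentiableAt ℝ f p :=
  (hf.contDiffAt (hU.mem_nhds hp)).differentiableAt (by simp)

theorem ContDiffOn.dirDeriv (hU : IsOpen U) (hf : ContDiffOn ℝ ∞ f U) (w : ℝ × ℝ) :
    ContDiffOn ℝ ∞ (dirDeriv w f) U :=
  ((contDiffOn_infty_iff_fderiv_of_isOpen hU).1 hf).2.clm_apply contDiffOn_const

theorem dirDeriv_congr (hU : IsOpen U) (h : ∀ q ∈ U, f q = g q) (hp : p ∈ U) :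
    dirDeriv w f p = dirDeriv w g p := by
  have : f =ᶠ[nhds p] g := Filter.eventually_of_mem (hU.mem_nhds hp) h
  simp only [dirDeriv, this.fderiv_eq]

theorem dirDeriv_eq_zero_of_const (hU : IsOpen U) {a : E} (h : ∀ q ∈ U, f q = a) (hp : p ∈ U) :
    dirDeriv w f p = 0 := by
  rw [dirDeriv_congr hU h hp]
  simp [dirDeriv]

theorem dirDeriv_comm (hU : IsOpen U) (hf : ContDiffOn ℝ ∞ f U) (hp : p ∈ U) :
    dirDeriv w (dirDeriv z f) p = dirDeriv z (dirDeriv w f) p := by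
  have hs : IsSymmSndFDerivAt ℝ f p :=
    (hf.contDiffAt (hU.mem_nhds hp)).isSymmSndFDerivAt
      (by simpa using ENat.LEInfty.out)
  have hd : DifferentiableAt ℝ (fderiv ℝ f) p :=
    ((contDiffOn_infty_iff_fderiv_of_isOpen hU).1 hf).2.differentiableAt_of_isOpen hU hp
  have key : ∀ a b : ℝ × ℝ, dirDeriv a (dirDeriv b f) p = fderiv ℝ (fderiv ℝ f) p a b := by
    intro a b
    have h1 : dirDeriv b f = fun q => fderiv ℝ f q b := rfl
    have h2 : HasFDerivAt (fun q => fderiv ℝ f q b)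
        ((fderiv ℝ (fderiv ℝ f) p).flip b) p := by
      simpa using hd.hasFDerivAt.clm_apply (hasFDerivAt_const b p)
    rw [h1, dirDeriv, h2.fderiv]
    rfl
  rw [key, key, hs w z]

theorem dirDeriv_add (hU : IsOpen U) (hf : ContDiffOn ℝ ∞ f U) (hg : ContDiffOn ℝ ∞ g U)
    (hp : p ∈ U) : dirDeriv w (fun q => f q + g q) p = dirDeriv w f p + dirDeriv w g p := by
  simp only [dirDeriv]
  rw [fderiv_fun_add (hf.differentiableAt_of_isOpen hU hp) (hg.differentiableAt_of_isOpen hU hp)]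
  rfl

theorem dirDeriv_smul {a : ℝ × ℝ → ℝ} (hU : IsOpen U) (ha : ContDiffOn ℝ ∞ a U)
    (hf : ContDiffOn ℝ ∞ f U) (hp : p ∈ U) :
    dirDeriv w (fun q => a q • f q) p = dirDeriv w a p • f p + a p • dirDeriv w f p := by
  simp only [dirDeriv]
  rw [fderiv_fun_smul (ha.differentiableAt_of_isOpen hU hp) (hf.differentiableAt_of_isOpen hU hp)]
  simp [add_comm]

theorem dirDeriv_const_smul (hU : IsOpen U) (a : ℝ) (hf : ContDiffOn ℝ ∞ f U) (hp : p ∈ U) :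
    dirDeriv w (fun q => a • f q) p = a • dirDeriv w f p := by
  simp only [dirDeriv]
  rw [fderiv_fun_const_smul (hf.differentiableAt_of_isOpen hU hp)]
  rfl

variable [FiniteDimensional ℝ E]

theorem ContDiffOn.linearMap {G : Type*} [NormedAddCommGroup G] [NormedSpace ℝ G]
    (L : E →ₗ[ℝ] G) (hf : ContDiffOn ℝ ∞ f U) : ContDiffOn ℝ ∞ (fun q => L (f q)) U :=
  (LinearMap.toContinuousLinearMap L).contDiff.comp_contDiffOn hf

theorem dirDeriv_linearMap {G : Type*} [NormedAddCommGroup G] [NormedSpace ℝ G]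
    (L : E →ₗ[ℝ] G) (hU : IsOpen U) (hf : ContDiffOn ℝ ∞ f U) (hp : p ∈ U) :
    dirDeriv w (fun q => L (f q)) p = L (dirDeriv w f p) := by
  have := ((LinearMap.toContinuousLinearMap L).hasFDerivAt.comp p
    (hf.differentiableAt_of_isOpen hU hp).hasFDerivAt).fderiv
  have h2 : (fun q => L (f q)) = (LinearMap.toContinuousLinearMap L) ∘ f := rfl
  rw [dirDeriv, h2, this]
  rfl

theorem ContDiffOn.bilin (B : LinearMap.BilinForm ℝ E) (hf : ContDiffOn ℝ ∞ f U)
    (hg : ContDiffOn ℝ ∞ g U) : ContDiffOn ℝ ∞ (fun q => B (f q) (g q)) U :=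
  (LinearMap.toContinuousBilinearMap B).isBoundedBilinearMap.contDiff.comp_contDiffOn
    (hf.prodMk hg)

theorem dirDeriv_bilin (B : LinearMap.BilinForm ℝ E) (hU : IsOpen U) (hf : ContDiffOn ℝ ∞ f U)
    (hg : ContDiffOn ℝ ∞ g U) (hp : p ∈ U) :
    dirDeriv w (fun q => B (f q) (g q)) p
      = B (dirDeriv w f p) (g p) + B (f p) (dirDeriv w g p) := by
  have := (LinearMap.toContinuousBilinearMap B).fderiv_of_bilinear
    (hf.differentiableAt_of_isOpen hU hp) (hg.differentiableAt_of_isOpen hU hp)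
  have h2 : (fun q => B (f q) (g q)) =
    fun q => (LinearMap.toContinuousBilinearMap B) (f q) (g q) := rfl
  rw [dirDeriv, h2, this]
  simp [dirDeriv, add_comm]

/-- Constancy of a scalar product moves a derivative from one factor to the other; the frame
coefficients below are found this way. -/
theorem bilin_dirDeriv_eq_neg (B : LinearMap.BilinForm ℝ E) (hU : IsOpen U)
    (hf : ContDiffOn ℝ ∞ f U) (hg : ContDiffOn ℝ ∞ g U) {a : ℝ} (h : ∀ q ∈ U, B (f q) (g q) = a)
    (hp : p ∈ U) (w : ℝ × ℝ) : B (dirDeriv w f p) (g p) = - B (f p) (dirDeriv w g p) := by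
  have h1 := dirDeriv_bilin (w := w) B hU hf hg hp
  rw [dirDeriv_eq_zero_of_const hU h hp] at h1
  linarith

end Calculus

/-! ### Frames of the conformal tangent bundle -/

section Frames

variable {E : Type*} [AddCommGroup E] [Module ℝ E]

/-- The Gram matrix of the moving frame `Y, Y_u, Y_v, N`. -/
structure IsNullFrame (B : LinearMap.BilinForm ℝ E) (σ : ℝ) (y a b n : E) : Prop where
  yy : B y y = 0
  ya : B y a = 0
  yb : B y b = 0
  yn : B y n = -1
  aa : B a a = 0
  ab : B a b = σ / 2
  an : B a n = 0
  bb : B b b = 0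
  bn : B b n = 0
  nn : B n n = 0

/-- The projection onto the orthogonal complement of the span of a null frame. -/
noncomputable def frameProj (B : LinearMap.BilinForm ℝ E) (σ : ℝ) (y a b n : E) : E →ₗ[ℝ] E where
  toFun x := x + B x n • y + B x y • n - (2 * σ * B x b) • a - (2 * σ * B x a) • b
  map_add' x x' := by simp only [map_add, LinearMap.add_apply]; module
  map_smul' t x := by
    simp only [map_smul, LinearMap.smul_apply, smul_eq_mul, RingHom.id_apply]; module

variable {B : LinearMap.BilinForm ℝ E} {σ : ℝ} {y a b n : E}

theorem frameProj_apply (x : E) : frameProj B σ y a b n x =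
    x + B x n • y + B x y • n - (2 * σ * B x b) • a - (2 * σ * B x a) • b := rfl

theorem frameProj_swap (x : E) : frameProj B σ y a b n x = frameProj B σ y b a n x := by
  simp only [frameProj_apply]; module

theorem decomp_frameProj (x : E) : x = (- B x n) • y + (- B x y) • n + (2 * σ * B x b) • a
    + (2 * σ * B x a) • b + frameProj B σ y a b n x := by
  simp only [frameProj_apply]; module

theorem frameProj_of_orthogonal {x : E} (hy : B x y = 0) (ha : B x a = 0) (hb : B x b = 0)
    (hn : B x n = 0) : frameProj B σ y a b n x = x := by
  simp [frameProj_apply, hy, ha, hb, hn]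

theorem frameProj_of_orthogonal_tangent {x : E} (hy : B x y = 0) (ha : B x a = 0)
    (hb : B x b = 0) : frameProj B σ y a b n x = x + B x n • y := by
  simp [frameProj_apply, hy, ha, hb]

namespace IsNullFrame

variable (hB : ∀ x x' : E, B x x' = B x' x) (hσ : σ * σ = 1) (h : IsNullFrame B σ y a b n)

include h

theorem proj_y : frameProj B σ y a b n y = 0 := by
  simp [frameProj_apply, h.yy, h.ya, h.yb, h.yn]

theorem inner_proj_n (x : E) : B (frameProj B σ y a b n x) n = 0 := by
  simp [frameProj_apply, h.yn, h.nn, h.an, h.bn]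

include hB

theorem inner_proj_y (x : E) : B (frameProj B σ y a b n x) y = 0 := by
  simp [frameProj_apply, hB n y, hB a y, hB b y, h.yy, h.ya, h.yb, h.yn]

theorem swap : IsNullFrame B σ y b a n :=
  ⟨h.yy, h.yb, h.ya, h.yn, h.bb, by rw [hB, h.ab], h.bn, h.aa, h.an, h.nn⟩

theorem proj_n : frameProj B σ y a b n n = 0 := by
  simp [frameProj_apply, hB n y, hB n a, hB n b, h.nn, h.an, h.bn, h.yn]

include hσ

theorem proj_a : frameProj B σ y a b n a = 0 := by
  have : 2 * σ * (σ / 2) = 1 := by linarith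
  simp [frameProj_apply, hB a y, h.an, h.ya, h.ab, h.aa, this]

theorem proj_b : frameProj B σ y a b n b = 0 := by
  have : 2 * σ * (σ / 2) = 1 := by linarith
  simp [frameProj_apply, hB b y, hB b a, h.bn, h.yb, h.ab, h.bb, this]

theorem inner_proj_a (x : E) : B (frameProj B σ y a b n x) a = 0 := by
  simp [frameProj_apply, h.ya, hB n a, hB b a, h.aa, h.an, h.ab]
  linear_combination (- B x a) * hσ

theorem inner_proj_b (x : E) : B (frameProj B σ y a b n x) b = 0 := by
  simp [frameProj_apply, h.yb, hB n b, h.bb, h.bn, h.ab]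
  linear_combination (- B x b) * hσ

/-- The projection differs from the identity by frame vectors, and a projected vector is orthogonal
to all of these. Hence ⟨Px, Px'⟩ = ⟨Px, x'⟩, and expanding Px gives the formula. -/
theorem inner_eq (x x' : E) : B x x' = - B x n * B x' y - B x y * B x' n
    + 2 * σ * (B x b * B x' a) + 2 * σ * (B x a * B x' b)
    + B (frameProj B σ y a b n x) (frameProj B σ y a b n x') := by
  have e : B (frameProj B σ y a b n x) (frameProj B σ y a b n x')
      = B (frameProj B σ y a b n x) x' := by
    rw [frameProj_apply x']
    simp only [map_add, map_sub, map_smul, h.inner_proj_y hB, h.inner_proj_n,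
      h.inner_proj_a hB hσ, h.inner_proj_b hB hσ]
    simp
  rw [e, frameProj_apply]
  simp only [map_add, map_sub, map_smul, LinearMap.add_apply, LinearMap.sub_apply,
    LinearMap.smul_apply, smul_eq_mul, hB _ x']
  ring

end IsNullFrame

end Frames

/-! ### Null lifts with respect to an ordered pair of directions -/

section NullLift

variable {E : Type*} [NormedAddCommGroup E] [NormedSpace ℝ E]

/-- `Y` is a smooth map into the light cone with induced metric `σ / 2 (dw ⊗ dz + dz ⊗ dw)`. -/
structure IsNullLift (B : LinearMap.BilinForm ℝ E) (σ : ℝ) (U : Set (ℝ × ℝ)) (w z : ℝ × ℝ)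
    (Y : ℝ × ℝ → E) : Prop where
  smooth : ContDiffOn ℝ ∞ Y U
  null : ∀ p ∈ U, B (Y p) (Y p) = 0
  ww : ∀ p ∈ U, B (dirDeriv w Y p) (dirDeriv w Y p) = 0
  zz : ∀ p ∈ U, B (dirDeriv z Y p) (dirDeriv z Y p) = 0
  wz : ∀ p ∈ U, B (dirDeriv w Y p) (dirDeriv z Y p) = σ / 2

/-- The null transversal `N` of a lift, with the directions `w`, `z` as parameters. -/
noncomputable def liftN (B : LinearMap.BilinForm ℝ E) (σ : ℝ) (w z : ℝ × ℝ) (Y : ℝ × ℝ → E)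
    (p : ℝ × ℝ) : E :=
  (2 * σ) • dirDeriv z (dirDeriv w Y) p
    + (2 * B (dirDeriv z (dirDeriv w Y) p) (dirDeriv z (dirDeriv w Y) p)) • Y p

/-- The projection onto the conformal normal bundle as a linear map. -/
noncomputable def liftProj (B : LinearMap.BilinForm ℝ E) (σ : ℝ) (w z : ℝ × ℝ) (Y : ℝ × ℝ → E)
    (p : ℝ × ℝ) : E →ₗ[ℝ] E :=
  frameProj B σ (Y p) (dirDeriv w Y p) (dirDeriv z Y p) (liftN B σ w z Y p)

/-- The Hopf differential in the direction `w`. -/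
noncomputable def liftHopf (B : LinearMap.BilinForm ℝ E) (σ : ℝ) (w z : ℝ × ℝ) (Y : ℝ × ℝ → E)
    (p : ℝ × ℝ) : E :=
  liftProj B σ w z Y p (dirDeriv w (dirDeriv w Y) p)

/-- The Schwarzian in the direction `w`. -/
noncomputable def liftSchwarz (B : LinearMap.BilinForm ℝ E) (σ : ℝ) (w z : ℝ × ℝ) (Y : ℝ × ℝ → E)
    (p : ℝ × ℝ) : ℝ :=
  2 * B (dirDeriv w (dirDeriv w Y) p) (liftN B σ w z Y p)

/-- Orthogonality to the conformal tangent bundle, expressed in the moving frame. -/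
structure IsFrameNormal (B : LinearMap.BilinForm ℝ E) (σ : ℝ) (w z : ℝ × ℝ) (Y : ℝ × ℝ → E)
    (p : ℝ × ℝ) (x : E) : Prop where
  oy : B x (Y p) = 0
  ow : B x (dirDeriv w Y p) = 0
  oz : B x (dirDeriv z Y p) = 0
  on : B x (liftN B σ w z Y p) = 0

variable {B : LinearMap.BilinForm ℝ E} {σ : ℝ} {U : Set (ℝ × ℝ)} {w z p : ℝ × ℝ}
  {Y : ℝ × ℝ → E}

theorem normalProj_eq (B : LinearMap.BilinForm ℝ E) (σ : ℝ) (Y : ℝ × ℝ → E) (p : ℝ × ℝ) (x : E) :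
    normalProj B σ Y p x = liftProj B σ (1, 0) (0, 1) Y p x := rfl

theorem hopfU_eq (B : LinearMap.BilinForm ℝ E) (σ : ℝ) (Y : ℝ × ℝ → E) (p : ℝ × ℝ) :
    hopfU B σ Y p = liftHopf B σ (1, 0) (0, 1) Y p := rfl

theorem IsCanonicalLift.isNullLift {y : ℝ × ℝ → Projectivization ℝ E}
    (h : IsCanonicalLift B σ U Y y) : IsNullLift B σ U (1, 0) (0, 1) Y :=
  ⟨h.smooth, h.null, h.metric_uu, h.metric_vv, h.metric_uv⟩

theorem IsFrameNormal.proj_eq {x : E} (h : IsFrameNormal B σ w z Y p x) :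
    liftProj B σ w z Y p x = x :=
  frameProj_of_orthogonal h.oy h.ow h.oz h.on

namespace IsNullLift

theorem mono (h : IsNullLift B σ U w z Y) {W : Set (ℝ × ℝ)} (hW : W ⊆ U) :
    IsNullLift B σ W w z Y :=
  ⟨h.smooth.mono hW, fun p hp => h.null p (hW hp), fun p hp => h.ww p (hW hp),
    fun p hp => h.zz p (hW hp), fun p hp => h.wz p (hW hp)⟩

/-- The roles of u and v are symmetric. Results are proved for the first direction `w` only and
carried over to `z` by exchanging the pair; equality of mixed derivatives makes `liftN` and
`liftProj` independent of the order. -/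
theorem swap (hB : ∀ x x' : E, B x x' = B x' x) (h : IsNullLift B σ U w z Y) :
    IsNullLift B σ U z w Y :=
  ⟨h.smooth, h.null, h.zz, h.ww, fun p hp => by rw [hB, h.wz p hp]⟩

theorem liftN_swap (hU : IsOpen U) (h : IsNullLift B σ U w z Y) (hp : p ∈ U) :
    liftN B σ z w Y p = liftN B σ w z Y p := by
  simp only [liftN, dirDeriv_comm (w := w) (z := z) hU h.smooth hp]

theorem liftProj_swap (hU : IsOpen U) (h : IsNullLift B σ U w z Y) (hp : p ∈ U) :
    liftProj B σ z w Y p = liftProj B σ w z Y p := by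
  ext x
  simp only [liftProj, h.liftN_swap hU hp, frameProj_swap x]

theorem isFrameNormal_swap (hU : IsOpen U) (h : IsNullLift B σ U w z Y) (hp : p ∈ U) {x : E}
    (hx : IsFrameNormal B σ w z Y p x) : IsFrameNormal B σ z w Y p x :=
  ⟨hx.oy, hx.oz, hx.ow, by rw [h.liftN_swap hU hp]; exact hx.on⟩

variable [FiniteDimensional ℝ E] (hB : ∀ x x' : E, B x x' = B x' x) (hU : IsOpen U)
  (h : IsNullLift B σ U w z Y) (hp : p ∈ U)

include hB hU h hp

theorem inner_y_w : B (Y p) (dirDeriv w Y p) = 0 := by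
  have := bilin_dirDeriv_eq_neg B hU h.smooth h.smooth h.null hp w
  rw [hB] at this
  linarith

theorem inner_y_z : B (Y p) (dirDeriv z Y p) = 0 := (h.swap hB).inner_y_w hB hU hp

theorem inner_y_wz : B (Y p) (dirDeriv w (dirDeriv z Y) p) = - (σ / 2) := by
  have := bilin_dirDeriv_eq_neg B hU h.smooth (h.smooth.dirDeriv hU z)
    (fun q hq => h.inner_y_z hB hU hq) hp w
  rw [h.wz p hp] at this
  linarith

theorem inner_y_ww : B (Y p) (dirDeriv w (dirDeriv w Y) p) = 0 := by
  have := bilin_dirDeriv_eq_neg B hU h.smooth (h.smooth.dirDeriv hU w)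
    (fun q hq => h.inner_y_w hB hU hq) hp w
  rw [h.ww p hp] at this
  linarith

theorem inner_w_zw : B (dirDeriv w Y p) (dirDeriv z (dirDeriv w Y) p) = 0 := by
  have := bilin_dirDeriv_eq_neg B hU (h.smooth.dirDeriv hU w) (h.smooth.dirDeriv hU w)
    h.ww hp z
  rw [hB] at this
  linarith

theorem inner_w_ww : B (dirDeriv w Y p) (dirDeriv w (dirDeriv w Y) p) = 0 := by
  have := bilin_dirDeriv_eq_neg B hU (h.smooth.dirDeriv hU w) (h.smooth.dirDeriv hU w)
    h.ww hp w
  rw [hB] at this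
  linarith

theorem inner_z_ww : B (dirDeriv z Y p) (dirDeriv w (dirDeriv w Y) p) = 0 := by
  have := bilin_dirDeriv_eq_neg B hU (h.smooth.dirDeriv hU w) (h.smooth.dirDeriv hU z)
    h.wz hp w
  rw [dirDeriv_comm (w := w) (z := z) hU h.smooth hp, h.inner_w_zw hB hU hp, hB] at this
  linarith

theorem inner_z_zw : B (dirDeriv z Y p) (dirDeriv z (dirDeriv w Y) p) = 0 := by
  rw [dirDeriv_comm hU h.smooth hp]
  exact (h.swap hB).inner_w_zw hB hU hp

/-- Since ⟨Y, Y_zw⟩ = -σ/2, the factor 2σ in N normalises ⟨Y, N⟩ to -1, and the multiple of Y is the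
one that makes N null. -/
theorem isNullFrame (hσ : σ * σ = 1) : IsNullFrame B σ (Y p) (dirDeriv w Y p) (dirDeriv z Y p)
    (liftN B σ w z Y p) := by
  have e0 := h.inner_y_wz hB hU hp
  rw [dirDeriv_comm hU h.smooth hp] at e0
  have e1 := h.inner_w_zw hB hU hp
  have e2 := h.inner_z_zw hB hU hp
  have e3 := h.inner_y_w hB hU hp
  have e4 := h.inner_y_z hB hU hp
  refine ⟨h.null p hp, e3, e4, ?_, h.ww p hp, h.wz p hp, ?_, h.zz p hp, ?_, ?_⟩
  · simp only [liftN, map_add, map_smul, smul_eq_mul, e0, h.null p hp]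
    linear_combination -hσ
  · simp only [liftN, map_add, map_smul, smul_eq_mul, e1, hB _ (Y p), e3]; ring
  · simp only [liftN, map_add, map_smul, smul_eq_mul, e2, hB _ (Y p), e4]; ring
  · simp only [liftN, map_add, map_smul, LinearMap.add_apply, LinearMap.smul_apply, smul_eq_mul,
      e0, hB _ (Y p), h.null p hp]
    linear_combination (4 * B (dirDeriv z (dirDeriv w Y) p) (dirDeriv z (dirDeriv w Y) p)
      - 4 * B (dirDeriv z (dirDeriv w Y) p) (dirDeriv z (dirDeriv w Y) p)) * hσ

theorem isFrameNormal_proj (hσ : σ * σ = 1) (x : E) :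
    IsFrameNormal B σ w z Y p (liftProj B σ w z Y p x) :=
  have f := h.isNullFrame hB hU hp hσ
  ⟨f.inner_proj_y hB x, f.inner_proj_a hB hσ x, f.inner_proj_b hB hσ x, f.inner_proj_n x⟩

/-- Y_ww is orthogonal to Y, Y_w and Y_z, so its frame expansion keeps only the Y term and the
normal part. -/
theorem dirDeriv_ww : dirDeriv w (dirDeriv w Y) p
    = (- (liftSchwarz B σ w z Y p / 2)) • Y p + liftHopf B σ w z Y p := by
  have e := decomp_frameProj (B := B) (σ := σ) (y := Y p) (a := dirDeriv w Y p)
    (b := dirDeriv z Y p) (n := liftN B σ w z Y p) (dirDeriv w (dirDeriv w Y) p)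
  rw [hB _ (Y p), h.inner_y_ww hB hU hp, hB _ (dirDeriv w Y p), h.inner_w_ww hB hU hp,
    hB _ (dirDeriv z Y p), h.inner_z_ww hB hU hp] at e
  rw [liftHopf, liftProj, liftSchwarz]
  refine e.trans ?_
  module

end IsNullLift

/-! ### Smoothness of the moving frame and its invariants -/

section Smooth

variable [FiniteDimensional ℝ E] (hU : IsOpen U) (hY : ContDiffOn ℝ ∞ Y U)

include hU hY

theorem contDiffOn_liftN : ContDiffOn ℝ ∞ (liftN B σ w z Y) U := by
  have h1 := (hY.dirDeriv hU w).dirDeriv hU z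
  exact (h1.const_smul (2 * σ)).add ((contDiffOn_const.mul (h1.bilin B h1)).smul hY)

theorem contDiffOn_liftProj {ξ : ℝ × ℝ → E} (hξ : ContDiffOn ℝ ∞ ξ U) :
    ContDiffOn ℝ ∞ (fun p => liftProj B σ w z Y p (ξ p)) U := by
  have hN := contDiffOn_liftN (B := B) (σ := σ) (w := w) (z := z) hU hY
  have hw := hY.dirDeriv hU w
  have hz := hY.dirDeriv hU z
  exact (((hξ.add ((hξ.bilin B hN).smul hY)).add ((hξ.bilin B hY).smul hN)).sub
    ((contDiffOn_const.mul (hξ.bilin B hz)).smul hw)).sub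
    ((contDiffOn_const.mul (hξ.bilin B hw)).smul hz)

theorem contDiffOn_liftHopf : ContDiffOn ℝ ∞ (liftHopf B σ w z Y) U :=
  contDiffOn_liftProj hU hY ((hY.dirDeriv hU w).dirDeriv hU w)

theorem contDiffOn_liftSchwarz : ContDiffOn ℝ ∞ (liftSchwarz B σ w z Y) U :=
  contDiffOn_const.mul
    (((hY.dirDeriv hU w).dirDeriv hU w).bilin B (contDiffOn_liftN hU hY))

end Smooth

/-! ### Structure equations -/

namespace IsNullLift

variable [FiniteDimensional ℝ E] (hB : ∀ x x' : E, B x x' = B x' x) (hU : IsOpen U)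
  (h : IsNullLift B 1 U w z Y) (hp : p ∈ U)

omit [FiniteDimensional ℝ E] in
include hU h hp in
theorem dirDeriv_wz : dirDeriv w (dirDeriv z Y) p = (1 / 2 : ℝ) • liftN B 1 w z Y p
    - B (dirDeriv z (dirDeriv w Y) p) (dirDeriv z (dirDeriv w Y) p) • Y p := by
  rw [liftN, dirDeriv_comm hU h.smooth hp]
  module

include hB hU h hp

/-- Both sides equal -⟨Y_wwz, Y_z⟩: differentiate ⟨Y_ww, Y_z⟩ = 0 along z and ⟨Y_zw, Y_z⟩ = 0 along
w. The Y components of Y_ww and Y_zz contribute nothing, as Y is null and orthogonal to the Hopf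
differentials. -/
theorem inner_zw_zw : B (dirDeriv z (dirDeriv w Y) p) (dirDeriv z (dirDeriv w Y) p)
    = B (liftHopf B 1 w z Y p) (liftHopf B 1 z w Y p) := by
  have sw := h.smooth.dirDeriv hU w
  have sz := h.smooth.dirDeriv hU z
  have nw := h.isFrameNormal_proj hB hU hp (one_mul 1) (dirDeriv w (dirDeriv w Y) p)
  have nz := (h.swap hB).isFrameNormal_proj hB hU hp (one_mul 1) (dirDeriv z (dirDeriv z Y) p)
  have e1 : B (dirDeriv w (dirDeriv w Y) p) (dirDeriv z (dirDeriv z Y) p)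
      = B (liftHopf B 1 w z Y p) (liftHopf B 1 z w Y p) := by
    rw [h.dirDeriv_ww hB hU hp, (h.swap hB).dirDeriv_ww hB hU hp]
    have a1 : B (liftHopf B 1 w z Y p) (Y p) = 0 := nw.oy
    have a2 : B (Y p) (liftHopf B 1 z w Y p) = 0 := by rw [hB]; exact nz.oy
    simp [a1, a2, h.null p hp]
  have e2 := bilin_dirDeriv_eq_neg B hU (sw.dirDeriv hU w) sz
    (fun q hq => by rw [hB]; exact h.inner_z_ww hB hU hq) hp z
  have e3 := bilin_dirDeriv_eq_neg B hU (sw.dirDeriv hU z) sz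
    (fun q hq => by rw [hB]; exact h.inner_z_zw hB hU hq) hp w
  rw [dirDeriv_comm hU sw hp, dirDeriv_comm (w := w) (z := z) (f := Y) hU h.smooth hp] at e3
  linarith

/-- The tangential coefficients come from differentiating the Gram relations of N. -/
theorem dirDeriv_liftN : dirDeriv w (liftN B 1 w z Y) p
    = (- liftSchwarz B 1 w z Y p) • dirDeriv z Y p
      - (2 * B (dirDeriv z (dirDeriv w Y) p) (dirDeriv z (dirDeriv w Y) p)) • dirDeriv w Y p
      + (2 : ℝ) • liftProj B 1 w z Y p (dirDeriv z (liftHopf B 1 w z Y) p) := by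
  have sw := h.smooth.dirDeriv hU w
  have sz := h.smooth.dirDeriv hU z
  have szw := sw.dirDeriv hU z
  have sN := contDiffOn_liftN (B := B) (σ := 1) (w := w) (z := z) hU h.smooth
  have sq := szw.bilin B szw
  have f := h.isNullFrame hB hU hp (one_mul 1)
  have eN := decomp_frameProj (B := B) (σ := 1) (y := Y p) (a := dirDeriv w Y p)
    (b := dirDeriv z Y p) (n := liftN B 1 w z Y p) (dirDeriv w (liftN B 1 w z Y) p)
  have c1 : B (dirDeriv w (liftN B 1 w z Y) p) (liftN B 1 w z Y p) = 0 := by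
    have := bilin_dirDeriv_eq_neg B hU sN sN
      (fun q hq => (h.isNullFrame hB hU hq (one_mul 1)).nn) hp w
    rw [hB (liftN B 1 w z Y p)] at this
    linarith
  have c2 : B (dirDeriv w (liftN B 1 w z Y) p) (Y p) = 0 := by
    rw [bilin_dirDeriv_eq_neg B hU sN h.smooth
      (fun q hq => by rw [hB]; exact (h.isNullFrame hB hU hq (one_mul 1)).yn) hp w, hB, f.an,
      neg_zero]
  have c3 : B (dirDeriv w (liftN B 1 w z Y) p) (dirDeriv z Y p)
      = - B (dirDeriv z (dirDeriv w Y) p) (dirDeriv z (dirDeriv w Y) p) := by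
    rw [bilin_dirDeriv_eq_neg B hU sN sz
      (fun q hq => by rw [hB]; exact (h.isNullFrame hB hU hq (one_mul 1)).bn) hp w,
      h.dirDeriv_wz (B := B) hU hp, map_sub, map_smul, map_smul, f.nn,
      hB (liftN B 1 w z Y p), f.yn, smul_eq_mul, smul_eq_mul]
    ring
  have c4 : B (dirDeriv w (liftN B 1 w z Y) p) (dirDeriv w Y p)
      = - (liftSchwarz B 1 w z Y p / 2) := by
    rw [bilin_dirDeriv_eq_neg B hU sN sw
      (fun q hq => by rw [hB]; exact (h.isNullFrame hB hU hq (one_mul 1)).an) hp w,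
      hB (liftN B 1 w z Y p), liftSchwarz]
    ring
  -- Modulo tangent vectors N_w is 2 Y_zww = 2 (Y_ww)_z, and Y_ww is its Hopf differential plus a
  -- multiple of Y; so its normal part is twice the normal derivative of the Hopf differential.
  have c5 : liftProj B 1 w z Y p (dirDeriv w (liftN B 1 w z Y) p)
      = (2 : ℝ) • liftProj B 1 w z Y p (dirDeriv z (liftHopf B 1 w z Y) p) := by
    have d1 : dirDeriv w (liftN B 1 w z Y) p
        = dirDeriv w (fun q => (2 * 1 : ℝ) • dirDeriv z (dirDeriv w Y) q
          + (2 * B (dirDeriv z (dirDeriv w Y) q) (dirDeriv z (dirDeriv w Y) q)) • Y q) p := rfl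
    have s1 : ContDiffOn ℝ ∞ (fun q => (2 * 1 : ℝ) • dirDeriv z (dirDeriv w Y) q) U :=
      contDiffOn_const.smul szw
    have s2 : ContDiffOn ℝ ∞
        (fun q => 2 * B (dirDeriv z (dirDeriv w Y) q) (dirDeriv z (dirDeriv w Y) q)) U :=
      contDiffOn_const.mul sq
    have s3 : ContDiffOn ℝ ∞ (fun q => (2 * B (dirDeriv z (dirDeriv w Y) q)
        (dirDeriv z (dirDeriv w Y) q)) • Y q) U := s2.smul h.smooth
    have s4 : ContDiffOn ℝ ∞ (fun q => - (liftSchwarz B 1 w z Y q / 2)) U :=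
      ((contDiffOn_liftSchwarz hU h.smooth).div_const 2).neg
    have s5 : ContDiffOn ℝ ∞ (fun q => (- (liftSchwarz B 1 w z Y q / 2)) • Y q) U :=
      s4.smul h.smooth
    rw [d1, dirDeriv_add hU s1 s3 hp, dirDeriv_const_smul hU _ szw hp,
      dirDeriv_smul hU s2 h.smooth hp,
      dirDeriv_comm hU sw hp, dirDeriv_congr hU (fun q hq => h.dirDeriv_ww hB hU hq) hp,
      dirDeriv_add hU s5 (contDiffOn_liftHopf hU h.smooth) hp, dirDeriv_smul hU s4 h.smooth hp]
    have p1 : liftProj B 1 w z Y p (Y p) = 0 := f.proj_y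
    have p2 : liftProj B 1 w z Y p (dirDeriv w Y p) = 0 := f.proj_a hB (one_mul 1)
    have p3 : liftProj B 1 w z Y p (dirDeriv z Y p) = 0 := f.proj_b hB (one_mul 1)
    simp only [map_add, map_smul, p1, p2, p3, smul_zero, zero_add, add_zero, mul_one]
  rw [c1, c2, c3, c4] at eN
  rw [liftProj] at c5
  rw [c5] at eN
  refine eN.trans ?_
  rw [liftProj]
  module

/-- The Weingarten equation for a section of the normal bundle. -/
theorem dirDeriv_normal {ν : ℝ × ℝ → E} (hν : ContDiffOn ℝ ∞ ν U)
    (hn : ∀ q ∈ U, IsFrameNormal B 1 w z Y q (ν q)) :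
    dirDeriv w ν p
      = (2 * B (ν p) (liftProj B 1 w z Y p (dirDeriv z (liftHopf B 1 w z Y) p))) • Y p
        - (2 * B (ν p) (liftHopf B 1 w z Y p)) • dirDeriv z Y p
        + liftProj B 1 w z Y p (dirDeriv w ν p) := by
  have sw := h.smooth.dirDeriv hU w
  have sz := h.smooth.dirDeriv hU z
  have sN := contDiffOn_liftN (B := B) (σ := 1) (w := w) (z := z) hU h.smooth
  have e := decomp_frameProj (B := B) (σ := 1) (y := Y p) (a := dirDeriv w Y p)
    (b := dirDeriv z Y p) (n := liftN B 1 w z Y p) (dirDeriv w ν p)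
  have c1 := bilin_dirDeriv_eq_neg B hU hν h.smooth (fun q hq => (hn q hq).oy) hp w
  have c2 := bilin_dirDeriv_eq_neg B hU hν sw (fun q hq => (hn q hq).ow) hp w
  have c3 := bilin_dirDeriv_eq_neg B hU hν sz (fun q hq => (hn q hq).oz) hp w
  have c4 := bilin_dirDeriv_eq_neg B hU hν sN (fun q hq => (hn q hq).on) hp w
  rw [(hn p hp).ow, neg_zero] at c1
  rw [h.dirDeriv_ww hB hU hp, map_add, map_smul, (hn p hp).oy, smul_zero, zero_add] at c2
  rw [h.dirDeriv_wz (B := B) hU hp, map_sub, map_smul, map_smul, (hn p hp).oy, (hn p hp).on,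
    smul_zero, smul_zero, sub_zero, neg_zero] at c3
  rw [h.dirDeriv_liftN hB hU hp, map_add, map_sub, map_smul, map_smul, map_smul, (hn p hp).ow,
    (hn p hp).oz, smul_zero, smul_zero, sub_zero, zero_add, smul_eq_mul] at c4
  rw [c1, c2, c3, c4] at e
  refine e.trans ?_
  rw [liftProj]
  module

end IsNullLift

end NullLift

/-! ### The isometry of the ambient space that extends an isomorphism of normal bundles -/

section Gauge

variable {E : Type*} [NormedAddCommGroup E] [NormedSpace ℝ E]

/-- An isomorphism of conformal normal bundles that preserves the Hopf differentials, in terms of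
moving frames with respect to an ordered pair of directions. -/
structure IsHopfIso (B : LinearMap.BilinForm ℝ E) (U : Set (ℝ × ℝ)) (w z : ℝ × ℝ)
    (Y Y' : ℝ × ℝ → E) (τ : ℝ × ℝ → E →ₗ[ℝ] E) : Prop where
  lift : IsNullLift B 1 U w z Y
  lift' : IsNullLift B 1 U w z Y'
  maps : ∀ p ∈ U, ∀ x, IsFrameNormal B 1 w z Y p x → IsFrameNormal B 1 w z Y' p (τ p x)
  inj : ∀ p ∈ U, ∀ x, IsFrameNormal B 1 w z Y p x → τ p x = 0 → x = 0
  isometric : ∀ p ∈ U, ∀ x x', IsFrameNormal B 1 w z Y p x → IsFrameNormal B 1 w z Y p x' →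
    B (τ p x) (τ p x') = B x x'
  smooth : ∀ ξ : ℝ × ℝ → E, ContDiffOn ℝ ∞ ξ U → (∀ p ∈ U, IsFrameNormal B 1 w z Y p (ξ p)) →
    ContDiffOn ℝ ∞ (fun p => τ p (ξ p)) U
  connW : ∀ ξ : ℝ × ℝ → E, ContDiffOn ℝ ∞ ξ U → (∀ p ∈ U, IsFrameNormal B 1 w z Y p (ξ p)) →
    ∀ p ∈ U, liftProj B 1 w z Y' p (dirDeriv w (fun q => τ q (ξ q)) p)
      = τ p (liftProj B 1 w z Y p (dirDeriv w ξ p))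
  connZ : ∀ ξ : ℝ × ℝ → E, ContDiffOn ℝ ∞ ξ U → (∀ p ∈ U, IsFrameNormal B 1 w z Y p (ξ p)) →
    ∀ p ∈ U, liftProj B 1 w z Y' p (dirDeriv z (fun q => τ q (ξ q)) p)
      = τ p (liftProj B 1 w z Y p (dirDeriv z ξ p))
  hopfW : ∀ p ∈ U, τ p (liftHopf B 1 w z Y p) = liftHopf B 1 w z Y' p
  hopfZ : ∀ p ∈ U, τ p (liftHopf B 1 z w Y p) = liftHopf B 1 z w Y' p

/-- The linear map that sends the moving frame of `Y` to that of `Y'` and is `τ` on the conformal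
normal bundle. -/
noncomputable def gaugeMap (B : LinearMap.BilinForm ℝ E) (w z : ℝ × ℝ) (Y Y' : ℝ × ℝ → E)
    (τ : ℝ × ℝ → E →ₗ[ℝ] E) (p : ℝ × ℝ) : E →ₗ[ℝ] E where
  toFun x := (- B x (liftN B 1 w z Y p)) • Y' p + (- B x (Y p)) • liftN B 1 w z Y' p
    + (2 * 1 * B x (dirDeriv z Y p)) • dirDeriv w Y' p
    + (2 * 1 * B x (dirDeriv w Y p)) • dirDeriv z Y' p + τ p (liftProj B 1 w z Y p x)
  map_add' x x' := by simp only [map_add, LinearMap.add_apply]; module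
  map_smul' t x := by
    simp only [map_smul, LinearMap.smul_apply, smul_eq_mul, RingHom.id_apply]; module

variable {B : LinearMap.BilinForm ℝ E} {U : Set (ℝ × ℝ)} {w z p : ℝ × ℝ}
  {Y Y' : ℝ × ℝ → E} {τ : ℝ × ℝ → E →ₗ[ℝ] E}

theorem gaugeMap_apply (x : E) : gaugeMap B w z Y Y' τ p x =
    (- B x (liftN B 1 w z Y p)) • Y' p + (- B x (Y p)) • liftN B 1 w z Y' p
    + (2 * 1 * B x (dirDeriv z Y p)) • dirDeriv w Y' p
    + (2 * 1 * B x (dirDeriv w Y p)) • dirDeriv z Y' p + τ p (liftProj B 1 w z Y p x) := rfl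

theorem gaugeMap_of_normal {x : E} (hx : IsFrameNormal B 1 w z Y p x) :
    gaugeMap B w z Y Y' τ p x = τ p x := by
  simp [gaugeMap_apply, hx.oy, hx.ow, hx.oz, hx.on, hx.proj_eq]

namespace IsHopfIso

variable (hU : IsOpen U) (hB : ∀ x x' : E, B x x' = B x' x) (h : IsHopfIso B U w z Y Y' τ)

include hU h in
theorem gaugeMap_swap (hp : p ∈ U) : gaugeMap B z w Y Y' τ p = gaugeMap B w z Y Y' τ p := by
  ext x
  simp only [gaugeMap_apply, h.lift.liftN_swap hU hp, h.lift'.liftN_swap hU hp,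
    h.lift.liftProj_swap hU hp]
  module

include hU hB h in
theorem swap : IsHopfIso B U z w Y Y' τ := by
  have hs := h.lift.swap hB
  have hs' := h.lift'.swap hB
  refine ⟨hs, hs', ?_, ?_, ?_, ?_, ?_, ?_, h.hopfZ, h.hopfW⟩
  · exact fun p hp x hx =>
      h.lift'.isFrameNormal_swap hU hp (h.maps p hp x (hs.isFrameNormal_swap hU hp hx))
  · exact fun p hp x hx => h.inj p hp x (hs.isFrameNormal_swap hU hp hx)
  · exact fun p hp x x' hx hx' => h.isometric p hp x x' (hs.isFrameNormal_swap hU hp hx)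
      (hs.isFrameNormal_swap hU hp hx')
  · exact fun ξ sξ hξ => h.smooth ξ sξ fun p hp => hs.isFrameNormal_swap hU hp (hξ p hp)
  · intro ξ sξ hξ p hp
    rw [h.lift.liftProj_swap hU hp, h.lift'.liftProj_swap hU hp]
    exact h.connZ ξ sξ (fun q hq => hs.isFrameNormal_swap hU hq (hξ q hq)) p hp
  · intro ξ sξ hξ p hp
    rw [h.lift.liftProj_swap hU hp, h.lift'.liftProj_swap hU hp]
    exact h.connW ξ sξ (fun q hq => hs.isFrameNormal_swap hU hq (hξ q hq)) p hp

variable [FiniteDimensional ℝ E]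

include hU hB h

theorem frame (hp : p ∈ U) : IsNullFrame B 1 (Y p) (dirDeriv w Y p) (dirDeriv z Y p)
    (liftN B 1 w z Y p) := h.lift.isNullFrame hB hU hp (one_mul 1)

theorem frame' (hp : p ∈ U) : IsNullFrame B 1 (Y' p) (dirDeriv w Y' p) (dirDeriv z Y' p)
    (liftN B 1 w z Y' p) := h.lift'.isNullFrame hB hU hp (one_mul 1)

theorem gaugeMap_y (hp : p ∈ U) : gaugeMap B w z Y Y' τ p (Y p) = Y' p := by
  have f := h.frame hU hB hp
  have e : liftProj B 1 w z Y p (Y p) = 0 := f.proj_y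
  simp [gaugeMap_apply, f.yy, f.ya, f.yb, f.yn, e]

theorem gaugeMap_n (hp : p ∈ U) :
    gaugeMap B w z Y Y' τ p (liftN B 1 w z Y p) = liftN B 1 w z Y' p := by
  have f := h.frame hU hB hp
  have e : liftProj B 1 w z Y p (liftN B 1 w z Y p) = 0 := f.proj_n hB
  simp [gaugeMap_apply, hB (liftN B 1 w z Y p) (Y p), hB _ (dirDeriv z Y p),
    hB _ (dirDeriv w Y p), f.nn, f.an, f.bn, f.yn, e]

theorem gaugeMap_w (hp : p ∈ U) :
    gaugeMap B w z Y Y' τ p (dirDeriv w Y p) = dirDeriv w Y' p := by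
  have f := h.frame hU hB hp
  have e : liftProj B 1 w z Y p (dirDeriv w Y p) = 0 := f.proj_a hB (one_mul 1)
  simp [gaugeMap_apply, hB (dirDeriv w Y p) (Y p), f.aa, f.an, f.ab, f.ya, e]

theorem gaugeMap_z (hp : p ∈ U) :
    gaugeMap B w z Y Y' τ p (dirDeriv z Y p) = dirDeriv z Y' p := by
  rw [← h.gaugeMap_swap hU hp]
  exact (h.swap hU hB).gaugeMap_w hU hB hp

/-- The two frames have equal Gram matrices and τ is isometric on normal vectors, so both sides have
the expansion `inner_eq`. -/
theorem inner_gaugeMap (hp : p ∈ U) (x x' : E) :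
    B (gaugeMap B w z Y Y' τ p x) (gaugeMap B w z Y Y' τ p x') = B x x' := by
  have f := h.frame' hU hB hp
  have hn := fun x => h.maps p hp _ (h.lift.isFrameNormal_proj hB hU hp (one_mul 1) x)
  have e := (h.frame hU hB hp).inner_eq hB (one_mul 1) x x'
  have e2 := h.isometric p hp _ _ (h.lift.isFrameNormal_proj hB hU hp (one_mul 1) x)
    (h.lift.isFrameNormal_proj hB hU hp (one_mul 1) x')
  rw [liftProj] at e2
  rw [e, ← e2, gaugeMap_apply, gaugeMap_apply]
  simp only [map_add, map_smul, LinearMap.add_apply, LinearMap.smul_apply, smul_eq_mul,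
    (hn x).oy, (hn x).ow, (hn x).oz, (hn x).on, hB _ (τ p (liftProj B 1 w z Y p x')),
    (hn x').oy, (hn x').ow, (hn x').oz, (hn x').on, f.yy, f.ya, f.yb, f.yn, f.aa, f.ab, f.an,
    f.bb, f.bn, f.nn, hB (liftN B 1 w z Y' p) (Y' p), hB (liftN B 1 w z Y' p) (dirDeriv w Y' p),
    hB (liftN B 1 w z Y' p) (dirDeriv z Y' p), hB (dirDeriv w Y' p) (Y' p),
    hB (dirDeriv z Y' p) (Y' p), hB (dirDeriv z Y' p) (dirDeriv w Y' p)]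
  rw [hB (τ p (liftProj B 1 w z Y p x')), liftProj]
  ring

/-- The form is not assumed non-degenerate. A vector in the kernel is orthogonal to everything,
hence normal, and on normal vectors the map is the injective τ. -/
theorem gaugeMap_injective (hp : p ∈ U) : Function.Injective (gaugeMap B w z Y Y' τ p) := by
  refine (injective_iff_map_eq_zero _).2 fun x hx => ?_
  have e : ∀ x', B x x' = 0 := fun x' => by
    rw [← h.inner_gaugeMap hU hB hp, hx, map_zero, LinearMap.zero_apply]
  have hx' : IsFrameNormal B 1 w z Y p x := ⟨e _, e _, e _, e _⟩
  rw [gaugeMap_of_normal hx'] at hx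
  exact h.inj p hp x hx' hx

theorem contDiffOn_gaugeMap {ξ : ℝ × ℝ → E} (hξ : ContDiffOn ℝ ∞ ξ U) :
    ContDiffOn ℝ ∞ (fun p => gaugeMap B w z Y Y' τ p (ξ p)) U := by
  have sY := h.lift.smooth
  have sY' := h.lift'.smooth
  have hν := h.smooth _ (contDiffOn_liftProj (B := B) (σ := 1) (w := w) (z := z) hU sY hξ)
    fun p hp => h.lift.isFrameNormal_proj hB hU hp (one_mul 1) _
  exact (((((hξ.bilin B (contDiffOn_liftN hU sY)).neg.smul sY').add
    ((hξ.bilin B sY).neg.smul (contDiffOn_liftN hU sY'))).add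
    ((contDiffOn_const.mul (hξ.bilin B (sY.dirDeriv hU z))).smul (sY'.dirDeriv hU w))).add
    ((contDiffOn_const.mul (hξ.bilin B (sY.dirDeriv hU w))).smul (sY'.dirDeriv hU z))).add hν

end IsHopfIso

/-- Differentiation of a section given in a moving frame. -/
theorem IsNullLift.dirDeriv_frame [FiniteDimensional ℝ E] (hU : IsOpen U)
    (hB : ∀ x x' : E, B x x' = B x' x) (h : IsNullLift B 1 U w z Y) {a b c d : ℝ × ℝ → ℝ}
    {ν : ℝ × ℝ → E} (sa : ContDiffOn ℝ ∞ a U) (sb : ContDiffOn ℝ ∞ b U)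
    (sc : ContDiffOn ℝ ∞ c U) (sd : ContDiffOn ℝ ∞ d U) (sν : ContDiffOn ℝ ∞ ν U)
    (hν : ∀ q ∈ U, IsFrameNormal B 1 w z Y q (ν q)) (hp : p ∈ U) :
    dirDeriv w (fun q => a q • Y q + b q • liftN B 1 w z Y q + c q • dirDeriv w Y q
        + d q • dirDeriv z Y q + ν q) p
      = dirDeriv w a p • Y p + a p • dirDeriv w Y p
      + (dirDeriv w b p • liftN B 1 w z Y p + b p • ((- liftSchwarz B 1 w z Y p) • dirDeriv z Y p
      - (2 * B (liftHopf B 1 w z Y p) (liftHopf B 1 z w Y p)) • dirDeriv w Y p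
      + (2 : ℝ) • liftProj B 1 w z Y p (dirDeriv z (liftHopf B 1 w z Y) p)))
      + (dirDeriv w c p • dirDeriv w Y p
        + c p • ((- (liftSchwarz B 1 w z Y p / 2)) • Y p + liftHopf B 1 w z Y p))
      + (dirDeriv w d p • dirDeriv z Y p + d p • ((1 / 2 : ℝ) • liftN B 1 w z Y p
        - B (liftHopf B 1 w z Y p) (liftHopf B 1 z w Y p) • Y p))
      + ((2 * B (ν p) (liftProj B 1 w z Y p (dirDeriv z (liftHopf B 1 w z Y) p))) • Y p
        - (2 * B (ν p) (liftHopf B 1 w z Y p)) • dirDeriv z Y p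
        + liftProj B 1 w z Y p (dirDeriv w ν p)) := by
  have sY := h.smooth
  have sN := contDiffOn_liftN (B := B) (σ := 1) (w := w) (z := z) hU sY
  have sw := sY.dirDeriv hU w
  have sz := sY.dirDeriv hU z
  have s1 : ContDiffOn ℝ ∞ (fun q => a q • Y q) U := sa.smul sY
  have s2 : ContDiffOn ℝ ∞ (fun q => b q • liftN B 1 w z Y q) U := sb.smul sN
  have s3 : ContDiffOn ℝ ∞ (fun q => c q • dirDeriv w Y q) U := sc.smul sw
  have s4 : ContDiffOn ℝ ∞ (fun q => d q • dirDeriv z Y q) U := sd.smul sz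
  rw [dirDeriv_add hU (((s1.add s2).add s3).add s4) sν hp,
    dirDeriv_add hU ((s1.add s2).add s3) s4 hp, dirDeriv_add hU (s1.add s2) s3 hp,
    dirDeriv_add hU s1 s2 hp, dirDeriv_smul hU sa sY hp, dirDeriv_smul hU sb sN hp,
    dirDeriv_smul hU sc sw hp, dirDeriv_smul hU sd sz hp,
    ← h.dirDeriv_normal hB hU hp sν hν, ← h.inner_zw_zw hB hU hp,
    ← h.dirDeriv_liftN hB hU hp, ← h.dirDeriv_wz (B := B) hU hp, ← h.dirDeriv_ww hB hU hp]

/-- With ξ expanded in the frame, the Schwarzian occurs only through N_w, with coefficient -⟨ξ, Y⟩,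
and through Y_ww, with coefficient 2⟨ξ, Y_z⟩. Replacing s by s + t in these two terms produces the
whole correction. -/
theorem IsHopfIso.dirDeriv_gaugeMap [FiniteDimensional ℝ E] (hU : IsOpen U)
    (hB : ∀ x x' : E, B x x' = B x' x) (h : IsHopfIso B U w z Y Y' τ) {t : ℝ}
    (hs : ∀ p ∈ U, liftSchwarz B 1 w z Y' p = liftSchwarz B 1 w z Y p + t)
    {ξ : ℝ × ℝ → E} (hξ : ContDiffOn ℝ ∞ ξ U) (hp : p ∈ U) :
    dirDeriv w (fun q => gaugeMap B w z Y Y' τ q (ξ q)) p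
      = gaugeMap B w z Y Y' τ p (dirDeriv w ξ p)
        + t • (B (ξ p) (Y p) • dirDeriv z Y' p - B (ξ p) (dirDeriv z Y p) • Y' p) := by
  have sY := h.lift.smooth
  have sν := contDiffOn_liftProj (B := B) (σ := 1) (w := w) (z := z) hU sY hξ
  have sa : ContDiffOn ℝ ∞ (fun q => - B (ξ q) (liftN B 1 w z Y q)) U :=
    (hξ.bilin B (contDiffOn_liftN hU sY)).neg
  have sb : ContDiffOn ℝ ∞ (fun q => - B (ξ q) (Y q)) U := (hξ.bilin B sY).neg
  have sc : ContDiffOn ℝ ∞ (fun q => 2 * 1 * B (ξ q) (dirDeriv z Y q)) U :=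
    contDiffOn_const.mul (hξ.bilin B (sY.dirDeriv hU z))
  have sd : ContDiffOn ℝ ∞ (fun q => 2 * 1 * B (ξ q) (dirDeriv w Y q)) U :=
    contDiffOn_const.mul (hξ.bilin B (sY.dirDeriv hU w))
  have hν : ∀ q ∈ U, IsFrameNormal B 1 w z Y q (liftProj B 1 w z Y q (ξ q)) :=
    fun q hq => h.lift.isFrameNormal_proj hB hU hq (one_mul 1) _
  have sκ := contDiffOn_liftHopf (B := B) (σ := 1) (w := w) (z := z) hU sY
  have hκ : ∀ q ∈ U, IsFrameNormal B 1 w z Y q (liftHopf B 1 w z Y q) :=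
    fun q hq => h.lift.isFrameNormal_proj hB hU hq (one_mul 1) _
  have hκz : IsFrameNormal B 1 w z Y p (liftHopf B 1 z w Y p) :=
    (h.lift.swap hB).isFrameNormal_swap hU hp
      ((h.lift.swap hB).isFrameNormal_proj hB hU hp (one_mul 1) _)
  have e := h.lift.dirDeriv_frame hU hB sa sb sc sd sν hν hp
  have e' := h.lift'.dirDeriv_frame hU hB sa sb sc sd (h.smooth _ sν hν)
    (fun q hq => h.maps q hq _ (hν q hq)) hp
  have eξ : dirDeriv w ξ p = _ :=
    dirDeriv_congr hU (fun q _ => decomp_frameProj (B := B) (σ := 1) (y := Y q)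
      (a := dirDeriv w Y q) (b := dirDeriv z Y q) (n := liftN B 1 w z Y q) (ξ q)) hp
  -- The normal derivative of the Hopf differential needs no separate hypothesis: τ respects both
  -- the connection and the Hopf differentials.
  have dκ : liftProj B 1 w z Y' p (dirDeriv z (liftHopf B 1 w z Y') p)
      = τ p (liftProj B 1 w z Y p (dirDeriv z (liftHopf B 1 w z Y) p)) := by
    rw [← h.connZ _ sκ hκ p hp, dirDeriv_congr hU h.hopfW hp]
  have nκ := h.lift.isFrameNormal_proj hB hU hp (one_mul 1) (dirDeriv z (liftHopf B 1 w z Y) p)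
  have nν := h.lift.isFrameNormal_proj hB hU hp (one_mul 1)
    (dirDeriv w (fun q => liftProj B 1 w z Y q (ξ q)) p)
  have i1 := h.isometric p hp _ _ (hκ p hp) hκz
  have i2 := h.isometric p hp _ _ (hν p hp) nκ
  have i3 := h.isometric p hp _ _ (hν p hp) (hκ p hp)
  rw [h.connW _ sν hν p hp, dκ, ← h.hopfW p hp, ← h.hopfZ p hp, hs p hp, i1, i2, i3] at e'
  have eT : (fun q => gaugeMap B w z Y Y' τ q (ξ q)) = fun q =>
    (- B (ξ q) (liftN B 1 w z Y q)) • Y' q + (- B (ξ q) (Y q)) • liftN B 1 w z Y' q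
    + (2 * 1 * B (ξ q) (dirDeriv z Y q)) • dirDeriv w Y' q
    + (2 * 1 * B (ξ q) (dirDeriv w Y q)) • dirDeriv z Y' q + τ q (liftProj B 1 w z Y q (ξ q)) := rfl
  rw [eT, e', eξ]
  have e2 : dirDeriv w (fun q => (- B (ξ q) (liftN B 1 w z Y q)) • Y q
      + (- B (ξ q) (Y q)) • liftN B 1 w z Y q + (2 * 1 * B (ξ q) (dirDeriv z Y q)) • dirDeriv w Y q
      + (2 * 1 * B (ξ q) (dirDeriv w Y q)) • dirDeriv z Y q
      + frameProj B 1 (Y q) (dirDeriv w Y q) (dirDeriv z Y q) (liftN B 1 w z Y q) (ξ q)) p = _ := e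
  rw [e2]
  simp only [map_add, map_sub, map_smul, h.gaugeMap_y hU hB hp, h.gaugeMap_n hU hB hp,
    h.gaugeMap_w hU hB hp, h.gaugeMap_z hU hB hp, gaugeMap_of_normal nκ, gaugeMap_of_normal nν,
    gaugeMap_of_normal (hκ p hp)]
  module

end Gauge

/-! ### Gauge transformations acting on enveloped null lifts -/

section Transform

variable {E : Type*} [NormedAddCommGroup E] [NormedSpace ℝ E]

/-- A family of isometries `T` with `T Y = Y'`, `T dY = dY'` whose logarithmic derivative is
`tw Y ∧ Y_z dw + tz Y ∧ Y_w dz`. -/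
structure IsGauge (B : LinearMap.BilinForm ℝ E) (U : Set (ℝ × ℝ)) (w z : ℝ × ℝ) (tw tz : ℝ)
    (Y Y' : ℝ × ℝ → E) (T : ℝ × ℝ → E →ₗ[ℝ] E) : Prop where
  inner : ∀ p ∈ U, ∀ x x', B (T p x) (T p x') = B x x'
  inj : ∀ p ∈ U, Function.Injective (T p)
  map_y : ∀ p ∈ U, T p (Y p) = Y' p
  map_w : ∀ p ∈ U, T p (dirDeriv w Y p) = dirDeriv w Y' p
  map_z : ∀ p ∈ U, T p (dirDeriv z Y p) = dirDeriv z Y' p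
  smooth : ∀ W, IsOpen W → W ⊆ U → ∀ ξ : ℝ × ℝ → E, ContDiffOn ℝ ∞ ξ W →
    ContDiffOn ℝ ∞ (fun p => T p (ξ p)) W
  derivW : ∀ W, IsOpen W → W ⊆ U → ∀ ξ : ℝ × ℝ → E, ContDiffOn ℝ ∞ ξ W → ∀ p ∈ W,
    dirDeriv w (fun q => T q (ξ q)) p = T p (dirDeriv w ξ p)
      + tw • (B (ξ p) (Y p) • dirDeriv z Y' p - B (ξ p) (dirDeriv z Y p) • Y' p)
  derivZ : ∀ W, IsOpen W → W ⊆ U → ∀ ξ : ℝ × ℝ → E, ContDiffOn ℝ ∞ ξ W → ∀ p ∈ W,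
    dirDeriv z (fun q => T q (ξ q)) p = T p (dirDeriv z ξ p)
      + tz • (B (ξ p) (Y p) • dirDeriv w Y' p - B (ξ p) (dirDeriv w Y p) • Y' p)

/-- The null lift `X` is related to `Y` as the canonical lift of a polar surface is. -/
structure IsPolarLift (B : LinearMap.BilinForm ℝ E) (σ : ℝ) (U : Set (ℝ × ℝ)) (w z : ℝ × ℝ)
    (bw bz : ℝ) (Y X : ℝ × ℝ → E) : Prop where
  lift : IsNullLift B σ U w z X
  smooth : ContDiffOn ℝ ∞ Y U
  inner : ∀ p ∈ U, B (X p) (Y p) = 0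
  spanW : ∀ p ∈ U, ∃ l a : ℝ, dirDeriv z Y p = l • Y p + a • X p + bw • dirDeriv w X p
  spanZ : ∀ p ∈ U, ∃ l a : ℝ, dirDeriv w Y p = l • Y p + a • X p + bz • dirDeriv z X p

variable {B : LinearMap.BilinForm ℝ E} {σ : ℝ} {U : Set (ℝ × ℝ)} {w z p : ℝ × ℝ}
  {tw tz bw bz : ℝ} {Y Y' X : ℝ × ℝ → E} {T : ℝ × ℝ → E →ₗ[ℝ] E}

theorem IsGauge.swap (h : IsGauge B U w z tw tz Y Y' T) : IsGauge B U z w tz tw Y Y' T :=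
  ⟨h.inner, h.inj, h.map_y, h.map_z, h.map_w, h.smooth, h.derivZ, h.derivW⟩

theorem IsGauge.mono (h : IsGauge B U w z tw tz Y Y' T) {V : Set (ℝ × ℝ)} (hV : V ⊆ U) :
    IsGauge B V w z tw tz Y Y' T :=
  ⟨fun p hp => h.inner p (hV hp), fun p hp => h.inj p (hV hp), fun p hp => h.map_y p (hV hp),
    fun p hp => h.map_w p (hV hp), fun p hp => h.map_z p (hV hp),
    fun W hW hWV => h.smooth W hW (hWV.trans hV), fun W hW hWV => h.derivW W hW (hWV.trans hV),
    fun W hW hWV => h.derivZ W hW (hWV.trans hV)⟩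

namespace IsPolarLift

variable (hU : IsOpen U) (hB : ∀ x x' : E, B x x' = B x' x)
  (h : IsPolarLift B σ U w z bw bz Y X) (hT : IsGauge B U w z tw tz Y Y' T)

include hB h in
theorem swap : IsPolarLift B σ U z w bz bw Y X :=
  ⟨h.lift.swap hB, h.smooth, h.inner, h.spanZ, h.spanW⟩

variable [FiniteDimensional ℝ E]

section Inner

include hU hB h

theorem inner_x_z (hp : p ∈ U) : B (X p) (dirDeriv z Y p) = 0 := by
  obtain ⟨l, a, e⟩ := h.spanW p hp
  simp [e, h.inner p hp, h.lift.null p hp, h.lift.inner_y_w hB hU hp]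

theorem inner_w_y (hp : p ∈ U) : B (dirDeriv w X p) (Y p) = 0 := by
  rw [bilin_dirDeriv_eq_neg B hU h.lift.smooth h.smooth h.inner hp, (h.swap hB).inner_x_z hU hB hp,
    neg_zero]

theorem inner_w_z (hp : p ∈ U) : B (dirDeriv w X p) (dirDeriv z Y p) = 0 := by
  obtain ⟨l, a, e⟩ := h.spanW p hp
  simp [e, h.inner_w_y hU hB hp, h.lift.ww p hp, hB _ (X p), h.lift.inner_y_w hB hU hp]

theorem inner_w_w (hp : p ∈ U) : B (dirDeriv w X p) (dirDeriv w Y p) = bz * (σ / 2) := by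
  obtain ⟨l, a, e⟩ := h.spanZ p hp
  simp [e, h.inner_w_y hU hB hp, h.lift.wz p hp, hB _ (X p), h.lift.inner_y_w hB hU hp]

theorem inner_ww_y (hp : p ∈ U) : B (dirDeriv w (dirDeriv w X) p) (Y p) = - (bz * (σ / 2)) := by
  rw [bilin_dirDeriv_eq_neg B hU (h.lift.smooth.dirDeriv hU w) h.smooth
    (fun q hq => h.inner_w_y hU hB hq) hp, h.inner_w_w hU hB hp]

end Inner

include hU hB h hT

/-- The correction pairs X with Y and Y_z, and both products vanish. -/
theorem map_dirDeriv (hp : p ∈ U) :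
    dirDeriv w (fun q => T q (X q)) p = T p (dirDeriv w X p) := by
  rw [hT.derivW U hU le_rfl X h.lift.smooth p hp, h.inner p hp, h.inner_x_z hU hB hp]
  simp

theorem map_dirDeriv_ww (hp : p ∈ U) :
    dirDeriv w (dirDeriv w (fun q => T q (X q))) p = T p (dirDeriv w (dirDeriv w X) p) := by
  rw [dirDeriv_congr hU (fun q hq => h.map_dirDeriv hU hB hT hq) hp,
    hT.derivW U hU le_rfl _ (h.lift.smooth.dirDeriv hU w) p hp, h.inner_w_y hU hB hp,
    h.inner_w_z hU hB hp]
  simp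

/-- Here the correction survives, because ⟨X_w, Y_w⟩ = bz σ/2 is not forced to vanish. It is the
source of the Schwarzian shift. -/
theorem map_dirDeriv_zw (hp : p ∈ U) :
    dirDeriv z (dirDeriv w (fun q => T q (X q))) p
      = T p (dirDeriv z (dirDeriv w X) p) - (tz * (bz * (σ / 2))) • Y' p := by
  rw [dirDeriv_congr hU (fun q hq => h.map_dirDeriv hU hB hT hq) hp,
    hT.derivZ U hU le_rfl _ (h.lift.smooth.dirDeriv hU w) p hp, h.inner_w_y hU hB hp,
    h.inner_w_w hU hB hp]
  module

theorem lift_map : IsNullLift B σ U w z (fun q => T q (X q)) := by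
  refine ⟨hT.smooth U hU le_rfl X h.lift.smooth, ?_, ?_, ?_, ?_⟩ <;> intro p hp
  · rw [hT.inner p hp, h.lift.null p hp]
  · rw [h.map_dirDeriv hU hB hT hp, hT.inner p hp, h.lift.ww p hp]
  · rw [(h.swap hB).map_dirDeriv hU hB hT.swap hp, hT.inner p hp, h.lift.zz p hp]
  · rw [h.map_dirDeriv hU hB hT hp, (h.swap hB).map_dirDeriv hU hB hT.swap hp, hT.inner p hp,
      h.lift.wz p hp]

omit h hT in
theorem _root_.IsNullLift.liftSchwarz_eq (hX : IsNullLift B σ U w z X) (hp : p ∈ U) :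
    liftSchwarz B σ w z X p
      = 4 * σ * B (dirDeriv w (dirDeriv w X) p) (dirDeriv z (dirDeriv w X) p) := by
  rw [liftSchwarz, liftN, map_add, map_smul, map_smul, hB _ (X p), hX.inner_y_ww hB hU hp]
  simp only [smul_eq_mul]
  ring

/-- The Schwarzian is 4σ⟨X_ww, X_zw⟩. The extra -tz bz (σ/2) Y' in the mixed derivative pairs with T
X_ww through ⟨X_ww, Y⟩ = -bz σ/2. -/
theorem liftSchwarz_map (hσ : σ * σ = 1) (hp : p ∈ U) :
    liftSchwarz B σ w z (fun q => T q (X q)) p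
      = liftSchwarz B σ w z X p + tz * bz * bz * σ := by
  rw [h.lift.liftSchwarz_eq hU hB hp, (h.lift_map hU hB hT).liftSchwarz_eq hU hB hp,
    h.map_dirDeriv_ww hU hB hT hp, h.map_dirDeriv_zw hU hB hT hp, map_sub, map_smul,
    ← hT.map_y p hp, hT.inner p hp, hT.inner p hp, h.inner_ww_y hU hB hp, smul_eq_mul]
  linear_combination (tz * bz * bz * σ) * hσ

/-- On vectors orthogonal to `X, X_w, X_z` the projection along `T X` composed with `T`. -/
theorem proj_map_of_orthogonal (hp : p ∈ U) {x : E} (hx : B x (X p) = 0)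
    (hw : B x (dirDeriv w X p) = 0) (hz : B x (dirDeriv z X p) = 0) :
    liftProj B σ w z (fun q => T q (X q)) p (T p x)
      = T p x + B (T p x) (liftN B σ w z (fun q => T q (X q)) p) • T p (X p) :=
  frameProj_of_orthogonal_tangent (by rw [hT.inner p hp, hx])
    (by rw [h.map_dirDeriv hU hB hT hp, hT.inner p hp, hw])
    (by rw [(h.swap hB).map_dirDeriv hU hB hT.swap hp, hT.inner p hp, hz])

/-- `T` intertwines the two projections on the orthogonal complement of `X`. -/
theorem proj_map_proj (hσ : σ * σ = 1) (hp : p ∈ U) {x : E} (hx : B x (X p) = 0) :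
    liftProj B σ w z (fun q => T q (X q)) p (T p (liftProj B σ w z X p x))
      = liftProj B σ w z (fun q => T q (X q)) p (T p x) := by
  have f := (h.lift_map hU hB hT).isNullFrame hB hU hp hσ
  have p1 : liftProj B σ w z (fun q => T q (X q)) p (T p (X p)) = 0 := f.proj_y
  have p2 : liftProj B σ w z (fun q => T q (X q)) p (T p (dirDeriv w X p)) = 0 := by
    rw [← h.map_dirDeriv hU hB hT hp]; exact f.proj_a hB hσ
  have p3 : liftProj B σ w z (fun q => T q (X q)) p (T p (dirDeriv z X p)) = 0 := by
    rw [← (h.swap hB).map_dirDeriv hU hB hT.swap hp]; exact f.proj_b hB hσ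
  have e : liftProj B σ w z X p x = _ := frameProj_apply x
  rw [e, hx]
  simp only [map_add, map_sub, map_smul, p1, p2, p3, smul_zero, zero_smul, add_zero, sub_zero]

theorem hopf_map (hσ : σ * σ = 1) (hp : p ∈ U) :
    liftProj B σ w z (fun q => T q (X q)) p (T p (liftHopf B σ w z X p))
      = liftHopf B σ w z (fun q => T q (X q)) p := by
  rw [liftHopf, h.proj_map_proj hU hB hT hσ hp
    (by rw [hB]; exact h.lift.inner_y_ww hB hU hp), ← h.map_dirDeriv_ww hU hB hT hp, liftHopf]

/-- The composition of `T` with the projection intertwines the normal connections. -/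
theorem conn_map (hσ : σ * σ = 1) {W : Set (ℝ × ℝ)} (hW : IsOpen W) (hWU : W ⊆ U) {ξ : ℝ × ℝ → E}
    (sξ : ContDiffOn ℝ ∞ ξ W) (hξ : ∀ q ∈ W, IsFrameNormal B σ w z X q (ξ q)) (hp : p ∈ W) :
    liftProj B σ w z (fun q => T q (X q)) p
        (dirDeriv w (fun q => liftProj B σ w z (fun q => T q (X q)) q (T q (ξ q))) p)
      = liftProj B σ w z (fun q => T q (X q)) p
        (T p (liftProj B σ w z X p (dirDeriv w ξ p))) := by
  have hX' := h.lift_map hU hB hT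
  have f := hX'.isNullFrame hB hU (hWU hp) hσ
  have p1 : liftProj B σ w z (fun q => T q (X q)) p (T p (X p)) = 0 := f.proj_y
  have p2 : liftProj B σ w z (fun q => T q (X q)) p
      (dirDeriv w (fun q => T q (X q)) p) = 0 := f.proj_a hB hσ
  have sX := h.lift.smooth.mono hWU
  have sX' := hX'.smooth.mono hWU
  have sT := hT.smooth W hW hWU ξ sξ
  have sN := contDiffOn_liftN (B := B) (σ := σ) (w := w) (z := z) hW sX'
  have sa := sT.bilin B sN
  have sb : ContDiffOn ℝ ∞ (fun q => B (T q (ξ q)) (liftN B σ w z (fun q => T q (X q)) q)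
    • T q (X q)) W := sa.smul sX'
  -- The projection changes Tξ only by a multiple of TX, and the derivative of that multiple lies in
  -- the span of TX and (TX)_w, which the outer projection kills.
  rw [dirDeriv_congr hW (fun q hq => h.proj_map_of_orthogonal hU hB hT (hWU hq) (hξ q hq).oy
      (hξ q hq).ow (hξ q hq).oz) hp, dirDeriv_add hW sT sb hp, dirDeriv_smul hW sa sX' hp,
    hT.derivW W hW hWU ξ sξ p hp, h.proj_map_proj hU hB hT hσ (hWU hp)
      (by rw [bilin_dirDeriv_eq_neg B hW sξ sX (fun q hq => (hξ q hq).oy) hp, (hξ p hp).ow,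
        neg_zero])]
  -- As ξ is orthogonal to X and X_w, it satisfies ⟨ξ, Y_z⟩ = l⟨ξ, Y⟩. The Y' terms of the
  -- correction then cancel, and what is left is tangent to TX.
  obtain ⟨l, a, e⟩ := h.spanW p (hWU hp)
  have e1 : B (ξ p) (dirDeriv z Y p) = l * B (ξ p) (Y p) := by
    simp [e, (hξ p hp).oy, (hξ p hp).ow]
  have e2 : dirDeriv z Y' p = l • Y' p + a • T p (X p) + bw • dirDeriv w (fun q => T q (X q)) p := by
    rw [← hT.map_z p (hWU hp), e, map_add, map_add, map_smul, map_smul, map_smul,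
      hT.map_y p (hWU hp), h.map_dirDeriv hU hB hT (hWU hp)]
  have e3 : B (ξ p) (Y p) • dirDeriv z Y' p - B (ξ p) (dirDeriv z Y p) • Y' p
      = (B (ξ p) (Y p) * a) • T p (X p)
        + (B (ξ p) (Y p) * bw) • dirDeriv w (fun q => T q (X q)) p := by
    rw [e1, e2]; module
  rw [e3]
  simp only [map_add, map_smul, p1, p2, smul_zero, add_zero]

end IsPolarLift

/-- Y_uv and N are interchangeable modulo Y, since N is 2σ Y_uv plus a multiple of Y and σ ≠ 0. -/
theorem mem_confNormal_iff (hB : ∀ x x' : E, B x x' = B x' x) (hσ : σ * σ = 1) {x : E} :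
    x ∈ confNormal B Y p ↔ IsFrameNormal B σ (1, 0) (0, 1) Y p x := by
  have hσ0 : σ ≠ 0 := fun e => by simp [e] at hσ
  have key : x ∈ confNormal B Y p ↔ ∀ a ∈ ({Y p, partialU Y p, partialV Y p,
      partialV (partialU Y) p} : Set E), B x a = 0 := by
    rw [confNormal, LinearMap.BilinForm.mem_orthogonal_iff]
    constructor
    · intro hx a ha
      rw [hB]
      exact hx a (Submodule.subset_span ha)
    · intro hx a ha
      have : confTangent Y p ≤ LinearMap.ker (B x) := Submodule.span_le.2 fun a ha => hx a ha
      have h2 := this ha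
      rw [LinearMap.mem_ker, hB] at h2
      exact h2
  rw [key]
  simp only [Set.mem_insert_iff, Set.mem_singleton_iff, forall_eq_or_imp, forall_eq]
  constructor
  · rintro ⟨h1, h2, h3, h4⟩
    exact ⟨h1, h2, h3, by
      rw [partialV_eq, partialU_eq] at h4
      simp [liftN, h1, h4]⟩
  · rintro ⟨h1, h2, h3, h4⟩
    refine ⟨h1, h2, h3, ?_⟩
    rw [partialV_eq, partialU_eq]
    simpa [liftN, h1, hσ0] using h4

theorem IsNullLift.hopfV_eq (hU : IsOpen U) (h : IsNullLift B σ U (1, 0) (0, 1) Y) (hp : p ∈ U) :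
    hopfV B σ Y p = liftHopf B σ (0, 1) (1, 0) Y p := by
  rw [liftHopf, h.liftProj_swap hU hp]; rfl

theorem IsNullLift.schwarzV_eq (hU : IsOpen U) (h : IsNullLift B σ U (1, 0) (0, 1) Y)
    (hp : p ∈ U) : schwarzV B σ Y p = liftSchwarz B σ (0, 1) (1, 0) Y p := by
  rw [liftSchwarz, h.liftN_swap hU hp]; rfl

/-- A gauge transformation with parameters `t`, `ε t` maps the canonical lift of a polar surface to
the canonical lift of a spectral transform. -/
theorem IsPolarLift.isSpectralTransform [FiniteDimensional ℝ E] (hU : IsOpen U)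
    (hB : ∀ x x' : E, B x x' = B x' x) {ε t : ℝ} (hε : ε * ε = 1)
    (h : IsPolarLift B ε U (1, 0) (0, 1) (-ε) (-1) Y X)
    (hT : IsGauge B U (1, 0) (0, 1) t (ε * t) Y Y' T)
    (hiso : ∀ p ∈ U, ∃ a b c : ℝ, dirDeriv (1, 0) (dirDeriv (1, 0) X) p
      = ε • dirDeriv (0, 1) (dirDeriv (0, 1) X) p + a • X p + b • dirDeriv (1, 0) X p
        + c • dirDeriv (0, 1) X p)
    {q q' : ℝ × ℝ → Projectivization ℝ E} (hq : IsLift U X q)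
    (hq' : IsLift U (fun p => T p (X p)) q') : IsSpectralTransform B ε ε t U q q' := by
  have hX' := h.lift_map hU hB hT
  have hswapX : ∀ p ∈ U, liftProj B ε (0, 1) (1, 0) X p = liftProj B ε (1, 0) (0, 1) X p :=
    fun p hp => h.lift.liftProj_swap hU hp
  have hswapX' : ∀ p ∈ U, liftProj B ε (0, 1) (1, 0) (fun p => T p (X p)) p
      = liftProj B ε (1, 0) (0, 1) (fun p => T p (X p)) p :=
    fun p hp => hX'.liftProj_swap hU hp
  have hisoX : IsIsothermicOn B ε ε U X := by
    intro p hp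
    obtain ⟨a, b, c, e⟩ := hiso p hp
    have f := h.lift.isNullFrame hB hU hp hε
    have p1 : liftProj B ε (1, 0) (0, 1) X p (X p) = 0 := f.proj_y
    have p2 : liftProj B ε (1, 0) (0, 1) X p (dirDeriv (1, 0) X p) = 0 := f.proj_a hB hε
    have p3 : liftProj B ε (1, 0) (0, 1) X p (dirDeriv (0, 1) X p) = 0 := f.proj_b hB hε
    rw [hopfU_eq, liftHopf, e, hopfV, normalProj_eq, partialV_eq, partialV_eq]
    simp only [map_add, map_smul, p1, p2, p3, smul_zero, add_zero]
  have hhU : ∀ p ∈ U, liftProj B ε (1, 0) (0, 1) (fun p => T p (X p)) p (T p (hopfU B ε X p))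
      = hopfU B ε (fun p => T p (X p)) p := fun p hp => h.hopf_map hU hB hT hε hp
  have hhV : ∀ p ∈ U, liftProj B ε (1, 0) (0, 1) (fun p => T p (X p)) p (T p (hopfV B ε X p))
      = hopfV B ε (fun p => T p (X p)) p := by
    intro p hp
    rw [h.lift.hopfV_eq hU hp, hX'.hopfV_eq hU hp, ← hswapX' p hp]
    exact (h.swap hB).hopf_map hU hB hT.swap hε hp
  -- T alone need not preserve normality, because the mixed derivative of TX has the extra Y' term;
  -- hence the projection after T.
  refine ⟨X, fun p => T p (X p),
    ⟨h.lift.smooth, hq, h.lift.null, h.lift.ww, h.lift.zz, h.lift.wz⟩,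
    ⟨hX'.smooth, hq', hX'.null, hX'.ww, hX'.zz, hX'.wz⟩, hisoX, ?_, ?_, ?_,
    fun p => liftProj B ε (1, 0) (0, 1) (fun p => T p (X p)) p ∘ₗ T p, ?_, hhU, hhV⟩
  · intro p hp
    rw [← hhU p hp, ← hhV p hp, hisoX p hp, map_smul, map_smul]
  · intro p hp
    -- Here tz = εt, bz = -1 and σ = ε, so the shift is ε²t = t. In the other direction tz = t and
    -- bz becomes -ε, which gives ε³t = εt.
    have := h.liftSchwarz_map hU hB hT hε hp
    refine this.trans ?_
    change _ = liftSchwarz B ε (1, 0) (0, 1) X p + t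
    linear_combination t * hε
  · intro p hp
    have := (h.swap hB).liftSchwarz_map hU hB hT.swap hε hp
    rw [h.lift.schwarzV_eq hU hp, hX'.schwarzV_eq hU hp, this]
    linear_combination (t * ε) * hε
  · refine ⟨?_, ?_, ?_, ?_, ?_⟩
    · intro p hp
      have hn := fun x => hX'.isFrameNormal_proj hB hU hp hε x
      have f := h.lift.isNullFrame hB hU hp hε
      refine ⟨fun x _ => (mem_confNormal_iff hB hε).2 (hn _), ?_, ?_⟩
      · intro x hx x' hx' e
        have nx := (mem_confNormal_iff hB hε).1 hx
        have nx' := (mem_confNormal_iff hB hε).1 hx'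
        simp only [LinearMap.comp_apply] at e
        rw [h.proj_map_of_orthogonal hU hB hT hp nx.oy nx.ow nx.oz,
          h.proj_map_of_orthogonal hU hB hT hp nx'.oy nx'.ow nx'.oz, ← map_smul, ← map_smul,
          ← map_add, ← map_add] at e
        -- Injectivity of T identifies x and x' up to multiples of X, which the projection along X
        -- removes.
        have e2 := congrArg (liftProj B ε (1, 0) (0, 1) X p) (hT.inj p hp e)
        have p1 : liftProj B ε (1, 0) (0, 1) X p (X p) = 0 := f.proj_y
        simpa only [map_add, map_smul, p1, smul_zero, add_zero, nx.proj_eq, nx'.proj_eq] using e2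
      · intro x' hx'
        have nx' := (mem_confNormal_iff hB hε).1 hx'
        -- In finite dimension the injective T is onto. The preimage is orthogonal to X because T is
        -- isometric, so projecting it does not change the projected image.
        obtain ⟨x, rfl⟩ := LinearMap.injective_iff_surjective.1 (hT.inj p hp) x'
        refine ⟨liftProj B ε (1, 0) (0, 1) X p x,
          (mem_confNormal_iff hB hε).2 (h.lift.isFrameNormal_proj hB hU hp hε x), ?_⟩
        have hx : B x (X p) = 0 := by rw [← hT.inner p hp]; exact nx'.oy
        simp only [LinearMap.comp_apply]
        rw [h.proj_map_proj hU hB hT hε hp hx, nx'.proj_eq]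
    · intro p hp x hx x' hx'
      have nx := (mem_confNormal_iff hB hε).1 hx
      have nx' := (mem_confNormal_iff hB hε).1 hx'
      simp only [LinearMap.comp_apply]
      rw [h.proj_map_of_orthogonal hU hB hT hp nx.oy nx.ow nx.oz,
        h.proj_map_of_orthogonal hU hB hT hp nx'.oy nx'.ow nx'.oz]
      simp [hT.inner p hp, nx.oy, hB (X p), nx'.oy, h.lift.null p hp]
    · intro W hW hWU ξ hξ
      exact contDiffOn_liftProj hW (hX'.smooth.mono hWU) (hT.smooth W hW hWU ξ hξ.1)
    · intro W hW hWU ξ hξ p hp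
      exact h.conn_map hU hB hT hε hW hWU hξ.1
        (fun q hq => (mem_confNormal_iff hB hε).1 (hξ.2 q hq)) hp
    · intro W hW hWU ξ hξ p hp
      have e := (h.swap hB).conn_map hU hB hT.swap hε hW hWU hξ.1
        (fun q hq => (h.lift.mono hWU).isFrameNormal_swap hW hq
          ((mem_confNormal_iff hB hε).1 (hξ.2 q hq))) hp
      rw [hswapX' p (hWU hp), hswapX p (hWU hp), dirDeriv_congr hW (fun q hq => by
        rw [hswapX' q (hWU hq)]) hp] at e
      exact e

end Transform

/-! ### Canonical lifts of the same surface, normal bundle isomorphisms -/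

section Lifts

variable {E : Type*} [NormedAddCommGroup E] [NormedSpace ℝ E]
  {B : LinearMap.BilinForm ℝ E} {U : Set (ℝ × ℝ)} {p : ℝ × ℝ} {Y Y' : ℝ × ℝ → E}

theorem IsLift.smul_left {X X' : ℝ × ℝ → E} {q : ℝ × ℝ → Projectivization ℝ E} (h : IsLift U X q)
    {a : ℝ × ℝ → ℝ} (ha : ∀ p ∈ U, a p ≠ 0) (hX' : ∀ p ∈ U, X' p = a p • X p) :
    IsLift U X' q := by
  intro p hp
  obtain ⟨h0, e⟩ := h p hp
  refine ⟨by rw [hX' p hp]; exact smul_ne_zero (ha p hp) h0, ?_⟩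
  rw [e, Projectivization.mk_eq_mk_iff']
  exact ⟨(a p)⁻¹, by rw [hX' p hp, smul_smul, inv_mul_cancel₀ (ha p hp), one_smul]⟩

theorem exists_isLift [Nontrivial E] {X : ℝ × ℝ → E} (h : ∀ p ∈ U, X p ≠ 0) :
    ∃ q : ℝ × ℝ → Projectivization ℝ E, IsLift U X q := by
  classical
  -- The class of v is an arbitrary value at points where X vanishes; these lie outside U.
  obtain ⟨v, hv⟩ := exists_ne (0 : E)
  refine ⟨fun p => if h0 : X p ≠ 0 then Projectivization.mk ℝ (X p) h0
    else Projectivization.mk ℝ v hv, fun p hp => ⟨h p hp, ?_⟩⟩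
  simp [h p hp]

/-- Two canonical lifts of the same surface agree up to a locally constant sign. -/
theorem IsCanonicalLift.exists_sign [FiniteDimensional ℝ E] (hU : IsOpen U)
    (hB : ∀ x x' : E, B x x' = B x' x) {y : ℝ × ℝ → Projectivization ℝ E}
    (h : IsCanonicalLift B 1 U Y y) (h' : IsCanonicalLift B 1 U Y' y) :
    ∃ f : ℝ × ℝ → ℝ, (∀ p ∈ U, f p * f p = 1) ∧ (∀ p ∈ U, Y' p = f p • Y p)
      ∧ ∀ w, ∀ p ∈ U, dirDeriv w f p = 0 := by
  have hn := h.isNullLift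
  have sY := h.smooth
  -- Since ⟨Y, Y_uv⟩ = -1/2, this is the proportionality factor of the two lifts, in a form that is
  -- visibly smooth. The metric forces g² = 1, and differentiating this gives g g_w = 0.
  set g : ℝ × ℝ → ℝ := fun p => -2 * B (Y' p) (dirDeriv (1, 0) (dirDeriv (0, 1) Y) p) with hg
  have sg : ContDiffOn ℝ ∞ g U :=
    contDiffOn_const.mul (h'.smooth.bilin B ((sY.dirDeriv hU _).dirDeriv hU _))
  have e : ∀ p ∈ U, Y' p = g p • Y p := by
    intro p hp
    obtain ⟨h0, e0⟩ := h.lift p hp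
    obtain ⟨h1, e1⟩ := h'.lift p hp
    rw [e0, eq_comm, Projectivization.mk_eq_mk_iff'] at e1
    obtain ⟨a, ha⟩ := e1
    have : g p = a := by
      simp only [hg, ← ha, map_smul, LinearMap.smul_apply, smul_eq_mul,
        hn.inner_y_wz hB hU hp]
      ring
    rw [this, ha]
  have d : ∀ w, ∀ p ∈ U, dirDeriv w Y' p = dirDeriv w g p • Y p + g p • dirDeriv w Y p :=
    fun w p hp => by rw [dirDeriv_congr hU e hp, dirDeriv_smul hU sg sY hp]
  have sq : ∀ p ∈ U, g p * g p = 1 := by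
    intro p hp
    have m := h'.isNullLift.wz p hp
    rw [d _ p hp, d _ p hp] at m
    simp only [map_add, map_smul, LinearMap.add_apply, LinearMap.smul_apply, smul_eq_mul,
      h.null p hp, hB _ (Y p), hn.inner_y_w hB hU hp, hn.inner_y_z hB hU hp, hn.wz p hp] at m
    linarith
  refine ⟨g, sq, e, fun w p hp => ?_⟩
  have s0 := dirDeriv_eq_zero_of_const (w := w) hU
    (f := fun q => g q • g q) (a := (1 : ℝ)) (fun q hq => sq q hq) hp
  rw [dirDeriv_smul hU sg sg hp, smul_eq_mul, smul_eq_mul] at s0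
  have : g p ≠ 0 := fun e0 => by simpa [e0] using sq p hp
  have h3 : g p * dirDeriv w g p = 0 := by linarith
  exact (mul_eq_zero.1 h3).resolve_left this

/-- Every frame vector is multiplied by the same locally constant sign, and each term of the
projection is quadratic in the frame. The lift used for a polar surface may thus be replaced by the
one used for the spectral transform. -/
theorem IsCanonicalLift.normalProj_congr [FiniteDimensional ℝ E] (hU : IsOpen U)
    (hB : ∀ x x' : E, B x x' = B x' x) {y : ℝ × ℝ → Projectivization ℝ E}
    (h : IsCanonicalLift B 1 U Y y) (h' : IsCanonicalLift B 1 U Y' y) (hp : p ∈ U) :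
    confNormal B Y' p = confNormal B Y p ∧ normalProj B 1 Y' p = normalProj B 1 Y p := by
  obtain ⟨f, f2, fe, fd⟩ := h.exists_sign hU hB h'
  have sY := h.smooth
  have hf : ContDiffOn ℝ ∞ f U := by
    have e : ∀ q ∈ U, f q = -2 * B (Y' q) (dirDeriv (1, 0) (dirDeriv (0, 1) Y) q) := by
      intro q hq
      rw [fe q hq, map_smul, LinearMap.smul_apply, smul_eq_mul, h.isNullLift.inner_y_wz hB hU hq]
      ring
    exact (contDiffOn_const.mul (h'.smooth.bilin B
      ((sY.dirDeriv hU _).dirDeriv hU _))).congr e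
  have d : ∀ w, ∀ q ∈ U, dirDeriv w Y' q = f q • dirDeriv w Y q := fun w q hq => by
    rw [dirDeriv_congr hU fe hq, dirDeriv_smul hU hf sY hq, fd w q hq, zero_smul, zero_add]
  have dd : dirDeriv (0, 1) (dirDeriv (1, 0) Y') p
      = f p • dirDeriv (0, 1) (dirDeriv (1, 0) Y) p := by
    rw [dirDeriv_congr hU (d _) hp, dirDeriv_smul hU hf (sY.dirDeriv hU _) hp, fd _ p hp,
      zero_smul, zero_add]
  have f0 : f p ≠ 0 := fun e0 => by simpa [e0] using f2 p hp
  have eN : liftN B 1 (1, 0) (0, 1) Y' p = f p • liftN B 1 (1, 0) (0, 1) Y p := by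
    simp only [liftN, dd, fe p hp, map_smul, LinearMap.smul_apply, smul_eq_mul]
    match_scalars
    · ring
    · linear_combination (2 * B (dirDeriv (0, 1) (dirDeriv (1, 0) Y) p)
        (dirDeriv (0, 1) (dirDeriv (1, 0) Y) p) * f p) * f2 p hp
  constructor
  · ext x
    rw [mem_confNormal_iff hB (one_mul 1), mem_confNormal_iff hB (one_mul 1)]
    constructor
    · rintro ⟨a1, a2, a3, a4⟩
      rw [fe p hp] at a1
      rw [d _ p hp] at a2 a3
      rw [eN] at a4
      simp only [map_smul, smul_eq_mul, mul_eq_zero, f0, false_or] at a1 a2 a3 a4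
      exact ⟨a1, a2, a3, a4⟩
    · rintro ⟨a1, a2, a3, a4⟩
      exact ⟨by rw [fe p hp, map_smul, a1, smul_zero], by rw [d _ p hp, map_smul, a2, smul_zero],
        by rw [d _ p hp, map_smul, a3, smul_zero], by rw [eN, map_smul, a4, smul_zero]⟩
  · funext x
    rw [normalProj_eq, normalProj_eq, liftProj, liftProj, frameProj_apply, frameProj_apply, eN,
      fe p hp, d _ p hp, d _ p hp]
    simp only [map_smul, smul_eq_mul]
    match_scalars
    · ring
    · linear_combination (B x (liftN B 1 (1, 0) (0, 1) Y p)) * f2 p hp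
    · linear_combination (B x (Y p)) * f2 p hp
    · linear_combination (-2 * B x (dirDeriv (0, 1) Y p)) * f2 p hp
    · linear_combination (-2 * B x (dirDeriv (1, 0) Y p)) * f2 p hp

theorem IsNormalBundleIso.isHopfIso {τ : ℝ × ℝ → E →ₗ[ℝ] E} (hB : ∀ x x' : E, B x x' = B x' x)
    (h : IsNullLift B 1 U (1, 0) (0, 1) Y) (h' : IsNullLift B 1 U (1, 0) (0, 1) Y')
    (hτ : IsNormalBundleIso B 1 U Y Y' τ)
    (hu : ∀ p ∈ U, τ p (hopfU B 1 Y p) = hopfU B 1 Y' p)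
    (hv : ∀ p ∈ U, τ p (hopfV B 1 Y p) = hopfV B 1 Y' p) {W : Set (ℝ × ℝ)} (hW : IsOpen W)
    (hWU : W ⊆ U) : IsHopfIso B W (1, 0) (0, 1) Y Y' τ := by
  have mem : ∀ {Y : ℝ × ℝ → E} {p : ℝ × ℝ} {x : E},
      x ∈ confNormal B Y p ↔ IsFrameNormal B 1 (1, 0) (0, 1) Y p x :=
    mem_confNormal_iff hB (one_mul 1)
  refine ⟨h.mono hWU, h'.mono hWU, ?_, ?_, ?_, ?_, ?_, ?_, fun p hp => hu p (hWU hp), ?_⟩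
  · exact fun p hp x hx => mem.1 ((hτ.bij p (hWU hp)).mapsTo (mem.2 hx))
  · exact fun p hp x hx e => (hτ.bij p (hWU hp)).injOn (mem.2 hx) (Submodule.zero_mem _)
      (by rw [e, map_zero])
  · exact fun p hp x x' hx hx' => hτ.isometric p (hWU hp) x (mem.2 hx) x' (mem.2 hx')
  · exact fun ξ sξ hξ => hτ.smooth W hW hWU ξ ⟨sξ, fun p hp => mem.2 (hξ p hp)⟩
  · exact fun ξ sξ hξ p hp => hτ.connU W hW hWU ξ ⟨sξ, fun p hp => mem.2 (hξ p hp)⟩ p hp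
  · exact fun ξ sξ hξ p hp => hτ.connV W hW hWU ξ ⟨sξ, fun p hp => mem.2 (hξ p hp)⟩ p hp
  · intro p hp
    rw [← (h.mono hWU).hopfV_eq hW hp, ← (h'.mono hWU).hopfV_eq hW hp]
    exact hv p (hWU hp)

/-- The gauge transformation of a spectral transform. -/
theorem IsNormalBundleIso.isGauge [FiniteDimensional ℝ E] {τ : ℝ × ℝ → E →ₗ[ℝ] E} (hU : IsOpen U)
    (hB : ∀ x x' : E, B x x' = B x' x)
    (h : IsNullLift B 1 U (1, 0) (0, 1) Y) (h' : IsNullLift B 1 U (1, 0) (0, 1) Y')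
    (hτ : IsNormalBundleIso B 1 U Y Y' τ)
    (hu : ∀ p ∈ U, τ p (hopfU B 1 Y p) = hopfU B 1 Y' p)
    (hv : ∀ p ∈ U, τ p (hopfV B 1 Y p) = hopfV B 1 Y' p) {tu tv : ℝ}
    (su : ∀ p ∈ U, schwarzU B 1 Y' p = schwarzU B 1 Y p + tu)
    (sv : ∀ p ∈ U, schwarzV B 1 Y' p = schwarzV B 1 Y p + tv) :
    IsGauge B U (1, 0) (0, 1) tu tv Y Y' (gaugeMap B (1, 0) (0, 1) Y Y' τ) := by
  have hi := fun {W : Set (ℝ × ℝ)} (hW : IsOpen W) (hWU : W ⊆ U) =>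
    hτ.isHopfIso hB h h' hu hv hW hWU
  have h0 := hi hU le_rfl
  refine ⟨fun p hp => h0.inner_gaugeMap hU hB hp, fun p hp => h0.gaugeMap_injective hU hB hp,
    fun p hp => h0.gaugeMap_y hU hB hp, fun p hp => h0.gaugeMap_w hU hB hp,
    fun p hp => h0.gaugeMap_z hU hB hp,
    fun W hW hWU ξ hξ => (hi hW hWU).contDiffOn_gaugeMap hW hB hξ, ?_, ?_⟩
  · exact fun W hW hWU ξ hξ p hp => (hi hW hWU).dirDeriv_gaugeMap hW hB
      (fun q hq => su q (hWU hq)) hξ hp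
  · intro W hW hWU ξ hξ p hp
    have hs := (hi hW hWU).swap hW hB
    have e := hs.dirDeriv_gaugeMap hW hB (t := tv) (fun q hq => by
      rw [← (h.mono hWU).schwarzV_eq hW hq, ← (h'.mono hWU).schwarzV_eq hW hq]
      exact sv q (hWU hq)) hξ hp
    rw [dirDeriv_congr hW (fun q hq => by rw [(hi hW hWU).gaugeMap_swap hW hq]) hp,
      (hi hW hWU).gaugeMap_swap hW hp] at e
    exact e

end Lifts

/-! ### Extending a gauge transformation to a larger ambient space -/

section Extension

variable {E F : Type*} [NormedAddCommGroup E] [NormedSpace ℝ E] [NormedAddCommGroup F]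
  [NormedSpace ℝ F]

/-- `ι` embeds `E` isometrically into `F` with adjoint projection `π`, and `e` is a vector with
`⟨e, e⟩ = -c` orthogonal to `E`, so that `x ↦ ι x + e` embeds the quadric `⟨x, x⟩ = c` into the
light cone of `F`. -/
structure IsConeEmbedding (B : LinearMap.BilinForm ℝ E) (C : LinearMap.BilinForm ℝ F) (c : ℝ)
    (ι : E →ₗ[ℝ] F) (π : F →ₗ[ℝ] E) (e : F) : Prop where
  symm : ∀ x x' : F, C x x' = C x' x
  leftInv : ∀ x, π (ι x) = x
  adjoint : ∀ x y, C (ι x) y = B x (π y)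
  proj_e : π e = 0
  inner_e : C e e = -c

/-- The extension of an endomorphism of `E` by the identity on the complement of `E` in `F`. -/
noncomputable def extendMap (ι : E →ₗ[ℝ] F) (π : F →ₗ[ℝ] E) (T : E →ₗ[ℝ] E) : F →ₗ[ℝ] F :=
  ι ∘ₗ T ∘ₗ π + (LinearMap.id - ι ∘ₗ π)

variable {B : LinearMap.BilinForm ℝ E} {C : LinearMap.BilinForm ℝ F} {c : ℝ}
  {ι : E →ₗ[ℝ] F} {π : F →ₗ[ℝ] E} {e : F}

theorem extendMap_apply (T : E →ₗ[ℝ] E) (x : F) :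
    extendMap ι π T x = ι (T (π x)) + (x - ι (π x)) := rfl

namespace IsConeEmbedding

variable (h : IsConeEmbedding B C c ι π e)

include h

theorem inner_map (x x' : E) : C (ι x) (ι x') = B x x' := by rw [h.adjoint, h.leftInv]

theorem inner_e_left (x : E) : C e (ι x) = 0 := by rw [h.symm, h.adjoint, h.proj_e, map_zero]

theorem inner_e_right (x : E) : C (ι x) e = 0 := by rw [h.adjoint, h.proj_e, map_zero]

theorem extendMap_ι (T : E →ₗ[ℝ] E) (x : E) : extendMap ι π T (ι x) = ι (T x) := by
  simp [extendMap_apply, h.leftInv]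

theorem extendMap_e (T : E →ₗ[ℝ] E) : extendMap ι π T e = e := by
  simp [extendMap_apply, h.proj_e]

variable [FiniteDimensional ℝ E] [FiniteDimensional ℝ F]

/-- The correction sees only the E component of a section, because ⟨ξ, ιY⟩ = ⟨πξ, Y⟩; the
complementary component is differentiated without correction. -/
theorem isGauge {U : Set (ℝ × ℝ)} {w z : ℝ × ℝ} {tw tz : ℝ} {Y Y' : ℝ × ℝ → E}
    {T : ℝ × ℝ → E →ₗ[ℝ] E} (hU : IsOpen U) (sY : ContDiffOn ℝ ∞ Y U) (sY' : ContDiffOn ℝ ∞ Y' U)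
    (hT : IsGauge B U w z tw tz Y Y' T) :
    IsGauge C U w z tw tz (fun p => ι (Y p)) (fun p => ι (Y' p))
      (fun p => extendMap ι π (T p)) := by
  have deriv : ∀ {w z : ℝ × ℝ} {t : ℝ}, (∀ W, IsOpen W → W ⊆ U → ∀ ξ : ℝ × ℝ → E,
      ContDiffOn ℝ ∞ ξ W → ∀ p ∈ W,
      dirDeriv w (fun q => T q (ξ q)) p = T p (dirDeriv w ξ p)
        + t • (B (ξ p) (Y p) • dirDeriv z Y' p - B (ξ p) (dirDeriv z Y p) • Y' p)) →
      ∀ W, IsOpen W → W ⊆ U → ∀ ξ : ℝ × ℝ → F, ContDiffOn ℝ ∞ ξ W → ∀ p ∈ W,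
      dirDeriv w (fun q => extendMap ι π (T q) (ξ q)) p = extendMap ι π (T p) (dirDeriv w ξ p)
        + t • (C (ξ p) (ι (Y p)) • dirDeriv z (fun q => ι (Y' q)) p
          - C (ξ p) (dirDeriv z (fun q => ι (Y q)) p) • ι (Y' p)) := by
    intro w z t H W hW hWU ξ sξ p hp
    have sπ := sξ.linearMap π
    have sT := hT.smooth W hW hWU _ sπ
    have s0 : ContDiffOn ℝ ∞ (fun q => (-1 : ℝ) • ι (π (ξ q))) W :=
      contDiffOn_const.smul (sπ.linearMap ι)
    have s1 : ContDiffOn ℝ ∞ (fun q => ξ q + (-1 : ℝ) • ι (π (ξ q))) W := sξ.add s0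
    have ext : (fun q => extendMap ι π (T q) (ξ q))
        = fun q => ι (T q (π (ξ q))) + (ξ q + (-1 : ℝ) • ι (π (ξ q))) := by
      funext q; rw [extendMap_apply]; module
    rw [ext, dirDeriv_add hW (sT.linearMap ι) s1 hp,
      dirDeriv_add hW sξ s0 hp,
      dirDeriv_const_smul hW _ (sπ.linearMap ι) hp, dirDeriv_linearMap ι hW sT hp,
      dirDeriv_linearMap ι hW sπ hp, H W hW hWU _ sπ p hp, dirDeriv_linearMap π hW sξ hp,
      dirDeriv_linearMap ι hU sY (hWU hp), dirDeriv_linearMap ι hU sY' (hWU hp),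
      h.symm (ξ p), h.symm (ξ p), h.adjoint, h.adjoint, extendMap_apply]
    -- Symmetry of the form on E is inherited from F through the isometric embedding.
    have b1 : B (Y p) (π (ξ p)) = B (π (ξ p)) (Y p) := by
      rw [← h.inner_map, h.symm, h.inner_map]
    have b2 : B (dirDeriv z Y p) (π (ξ p)) = B (π (ξ p)) (dirDeriv z Y p) := by
      rw [← h.inner_map, h.symm, h.inner_map]
    rw [b1, b2]
    simp only [map_add, map_sub, map_smul]
    module
  refine ⟨?_, ?_, ?_, ?_, ?_, ?_, deriv hT.derivW, deriv hT.derivZ⟩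
  · intro p hp x x'
    simp only [extendMap_apply, map_add, map_sub, LinearMap.add_apply, LinearMap.sub_apply,
      h.symm x (ι _), h.adjoint, h.leftInv, hT.inner p hp]
    have b : ∀ a b : E, B a b = B b a := fun a b => by rw [← h.inner_map, h.symm, h.inner_map]
    rw [b (π x') (π x), b (T p (π x')) (π x)]
    ring
  · intro p hp
    refine (injective_iff_map_eq_zero _).2 fun x hx => ?_
    have e1 := congrArg π hx
    simp only [extendMap_apply, map_add, map_sub, h.leftInv, sub_self, add_zero, map_zero] at e1
    have e2 : π x = 0 := hT.inj p hp (by rw [e1, map_zero])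
    simpa [extendMap_apply, e2] using hx
  · exact fun p hp => by rw [h.extendMap_ι, hT.map_y p hp]
  · exact fun p hp => by
      rw [dirDeriv_linearMap ι hU sY hp, dirDeriv_linearMap ι hU sY' hp, h.extendMap_ι,
        hT.map_w p hp]
  · exact fun p hp => by
      rw [dirDeriv_linearMap ι hU sY hp, dirDeriv_linearMap ι hU sY' hp, h.extendMap_ι,
        hT.map_z p hp]
  · intro W hW hWU ξ sξ
    have sπ := sξ.linearMap π
    exact ((hT.smooth W hW hWU _ sπ).linearMap ι).add (sξ.sub (sπ.linearMap ι))

end IsConeEmbedding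

end Extension

/-! ### Parallel sections of the conformal normal bundle -/

section Polar

variable {E : Type*} [NormedAddCommGroup E] [NormedSpace ℝ E] [FiniteDimensional ℝ E]
  {B : LinearMap.BilinForm ℝ E} {U : Set (ℝ × ℝ)} {w z p : ℝ × ℝ} {Y ψ : ℝ × ℝ → E}

/-- The derivative of a parallel section of the conformal normal bundle. -/
theorem IsNullLift.dirDeriv_parallel (hU : IsOpen U) (hB : ∀ x x' : E, B x x' = B x' x)
    (h : IsNullLift B 1 U w z Y) (sψ : ContDiffOn ℝ ∞ ψ U)
    (hn : ∀ q ∈ U, IsFrameNormal B 1 w z Y q (ψ q))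
    (hw : ∀ q ∈ U, liftProj B 1 w z Y q (dirDeriv w ψ q) = 0)
    (hz : ∀ q ∈ U, liftProj B 1 w z Y q (dirDeriv z ψ q) = 0) (hp : p ∈ U) :
    dirDeriv w ψ p
      = (2 * dirDeriv z (fun q => B (ψ q) (liftHopf B 1 w z Y q)) p) • Y p
        - (2 * B (ψ p) (liftHopf B 1 w z Y p)) • dirDeriv z Y p := by
  have sκ := contDiffOn_liftHopf (B := B) (σ := 1) (w := w) (z := z) hU h.smooth
  have hκ := h.isFrameNormal_proj hB hU hp (one_mul 1) (dirDeriv w (dirDeriv w Y) p)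
  have e1 := h.dirDeriv_normal hB hU hp sψ hn
  have e2 := (h.swap hB).dirDeriv_normal hB hU hp sψ fun q hq =>
    h.isFrameNormal_swap hU hq (hn q hq)
  rw [h.liftProj_swap hU hp, hz p hp, add_zero] at e2
  rw [hw p hp, add_zero] at e1
  have e3 : B (ψ p) (liftProj B 1 w z Y p (dirDeriv z (liftHopf B 1 w z Y) p))
      = B (ψ p) (dirDeriv z (liftHopf B 1 w z Y) p) := by
    have : liftProj B 1 w z Y p (dirDeriv z (liftHopf B 1 w z Y) p) = _ := frameProj_apply _
    rw [this]
    simp [(hn p hp).oy, (hn p hp).ow, (hn p hp).oz, (hn p hp).on]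
  -- For parallel ψ the derivative ψ_z lies in the span of Y and Y_w, which is orthogonal to the
  -- Hopf differential. So the derivative can be taken outside the scalar product with ψ.
  have e4 : B (dirDeriv z ψ p) (liftHopf B 1 w z Y p) = 0 := by
    rw [hB, e2, map_sub, map_smul, map_smul]
    have a1 : B (liftHopf B 1 w z Y p) (Y p) = 0 := hκ.oy
    have a2 : B (liftHopf B 1 w z Y p) (dirDeriv w Y p) = 0 := hκ.ow
    simp [a1, a2]
  rw [dirDeriv_bilin B hU sψ sκ hp, e4, zero_add, ← e3]
  exact e1

/-- A parallel section of the conformal normal bundle of an isothermic surface: `k` is its inner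
product with `κ₂`. -/
structure IsPolarPair (B : LinearMap.BilinForm ℝ E) (ε c : ℝ) (U : Set (ℝ × ℝ))
    (Y ψ : ℝ × ℝ → E) (k : ℝ × ℝ → ℝ) : Prop where
  lift : IsNullLift B 1 U (1, 0) (0, 1) Y
  smooth : ContDiffOn ℝ ∞ ψ U
  smooth_k : ContDiffOn ℝ ∞ k U
  k_eq : ∀ p ∈ U, B (ψ p) (hopfV B 1 Y p) = k p
  normal : ∀ p ∈ U, IsFrameNormal B 1 (1, 0) (0, 1) Y p (ψ p)
  length : ∀ p ∈ U, B (ψ p) (ψ p) = c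
  deriv_u : ∀ p ∈ U, dirDeriv (1, 0) ψ p
    = (2 * ε * dirDeriv (0, 1) k p) • Y p - (2 * ε * k p) • dirDeriv (0, 1) Y p
  deriv_v : ∀ p ∈ U, dirDeriv (0, 1) ψ p
    = (2 * dirDeriv (1, 0) k p) • Y p - (2 * k p) • dirDeriv (1, 0) Y p

/-- The isothermic condition gives ⟨ψ, κ₁⟩ = ε⟨ψ, κ₂⟩, so one function k governs both derivatives of
ψ. -/
theorem IsNullLift.isPolarPair (hU : IsOpen U) (hB : ∀ x x' : E, B x x' = B x' x) {ε c : ℝ}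
    (h : IsNullLift B 1 U (1, 0) (0, 1) Y) (hiso : IsIsothermicOn B 1 ε U Y)
    (sψ : ContDiffOn ℝ ∞ ψ U)
    (hn : ∀ q ∈ U, IsFrameNormal B 1 (1, 0) (0, 1) Y q (ψ q))
    (hu : ∀ q ∈ U, liftProj B 1 (1, 0) (0, 1) Y q (dirDeriv (1, 0) ψ q) = 0)
    (hv : ∀ q ∈ U, liftProj B 1 (1, 0) (0, 1) Y q (dirDeriv (0, 1) ψ q) = 0)
    (hc : ∀ q ∈ U, B (ψ q) (ψ q) = c) :
    IsPolarPair B ε c U Y ψ (fun p => B (ψ p) (hopfV B 1 Y p)) := by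
  have sκ := contDiffOn_liftHopf (B := B) (σ := 1) (w := (0, 1)) (z := (1, 0)) hU h.smooth
  have hsw : ∀ q ∈ U, IsFrameNormal B 1 (0, 1) (1, 0) Y q (ψ q) :=
    fun q hq => h.isFrameNormal_swap hU hq (hn q hq)
  have sk : ContDiffOn ℝ ∞ (fun p => B (ψ p) (hopfV B 1 Y p)) U :=
    (sψ.bilin B sκ).congr fun q hq => by rw [h.hopfV_eq hU hq]
  refine ⟨h, sψ, sk, fun _ _ => rfl, hn, hc, ?_, ?_⟩
  · intro p hp
    have e := h.dirDeriv_parallel hU hB sψ hn hu hv hp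
    have ek : ∀ q ∈ U, B (ψ q) (liftHopf B 1 (1, 0) (0, 1) Y q)
        = ε • B (ψ q) (hopfV B 1 Y q) := by
      intro q hq
      rw [← hopfU_eq, hiso q hq, map_smul]
    rw [dirDeriv_congr hU ek hp, dirDeriv_const_smul hU _ sk hp, ek p hp, smul_eq_mul,
      smul_eq_mul] at e
    rw [e, mul_assoc, mul_assoc]
  · intro p hp
    have e := (h.swap hB).dirDeriv_parallel hU hB sψ hsw
      (fun q hq => by rw [h.liftProj_swap hU hq]; exact hv q hq)
      (fun q hq => by rw [h.liftProj_swap hU hq]; exact hu q hq) hp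
    have ek : ∀ q ∈ U, B (ψ q) (liftHopf B 1 (0, 1) (1, 0) Y q) = B (ψ q) (hopfV B 1 Y q) :=
      fun q hq => by rw [h.hopfV_eq hU hq]
    rw [dirDeriv_congr hU ek hp, ek p hp] at e
    exact e

namespace IsPolarPair

variable {ε c : ℝ} {k : ℝ × ℝ → ℝ} (h : IsPolarPair B ε c U Y ψ k)

include h

omit [FiniteDimensional ℝ E] in
theorem mono {W : Set (ℝ × ℝ)} (hWU : W ⊆ U) : IsPolarPair B ε c W Y ψ k :=
  ⟨h.lift.mono hWU, h.smooth.mono hWU, h.smooth_k.mono hWU, fun p hp => h.k_eq p (hWU hp),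
    fun p hp => h.normal p (hWU hp), fun p hp => h.length p (hWU hp),
    fun p hp => h.deriv_u p (hWU hp), fun p hp => h.deriv_v p (hWU hp)⟩

variable (hU : IsOpen U) (hB : ∀ x x' : E, B x x' = B x' x) (hp : p ∈ U)

include hU hB hp

theorem inner_u_u : B (dirDeriv (1, 0) ψ p) (dirDeriv (1, 0) ψ p) = 0 := by
  rw [h.deriv_u p hp]
  simp [h.lift.null p hp, h.lift.zz p hp, hB _ (Y p), h.lift.inner_y_z hB hU hp]

theorem inner_v_v : B (dirDeriv (0, 1) ψ p) (dirDeriv (0, 1) ψ p) = 0 := by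
  rw [h.deriv_v p hp]
  simp [h.lift.null p hp, h.lift.ww p hp, hB _ (Y p), h.lift.inner_y_w hB hU hp]

theorem inner_u_v : B (dirDeriv (1, 0) ψ p) (dirDeriv (0, 1) ψ p) = 2 * ε * (k p * k p) := by
  rw [h.deriv_v p hp, h.deriv_u p hp]
  simp [h.lift.null p hp, h.lift.wz p hp, hB (dirDeriv (0, 1) Y p),
    h.lift.inner_y_w hB hU hp, h.lift.inner_y_z hB hU hp]
  ring

omit hp in
-- The induced metric is off-diagonal with entry 2εk², so its determinant is -4k⁴.
theorem regularSet_eq (hε : ε * ε = 1) : regularSet B U ψ = {p ∈ U | k p ≠ 0} := by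
  ext p
  simp only [regularSet, Set.mem_ofPred_eq]
  refine and_congr_right fun hp => not_congr ?_
  rw [partialU_eq, partialV_eq, h.inner_u_u hU hB hp, h.inner_v_v hU hB hp, h.inner_u_v hU hB hp]
  constructor
  · intro e
    have : (k p) ^ 4 = 0 := by linear_combination (-1 / 4 : ℝ) * e - (k p) ^ 4 * hε
    exact pow_eq_zero_iff (by norm_num) |>.1 this
  · intro e
    rw [e]; ring

omit [FiniteDimensional ℝ E] hB in
-- The k_uv Y and k Y_uv terms agree in ψ_uu and εψ_vv, leaving 4ε(k_v Y_u - k_u Y_v). With r =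
-- 1/(2k) the vectors Y_u and Y_v are recovered from ψ_v and ψ_u modulo Y, and the Y terms cancel.
theorem deriv_uu_sub {r : ℝ} (hr : 2 * k p * r = 1) :
    dirDeriv (1, 0) (dirDeriv (1, 0) ψ) p = ε • dirDeriv (0, 1) (dirDeriv (0, 1) ψ) p
      + (4 * r * dirDeriv (1, 0) k p) • dirDeriv (1, 0) ψ p
      - (4 * r * ε * dirDeriv (0, 1) k p) • dirDeriv (0, 1) ψ p := by
  have sY := h.lift.smooth
  have sk := h.smooth_k
  have ext : ∀ (b : ℝ) (w w' : ℝ × ℝ), dirDeriv w (fun q =>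
      (b * dirDeriv w' k q) • Y q - (b * k q) • dirDeriv w' Y q) p
      = b • (dirDeriv w (dirDeriv w' k) p • Y p + dirDeriv w' k p • dirDeriv w Y p)
        - b • (dirDeriv w k p • dirDeriv w' Y p + k p • dirDeriv w (dirDeriv w' Y) p) := by
    intro b w w'
    have s1 : ContDiffOn ℝ ∞ (fun q => dirDeriv w' k q • Y q) U := (sk.dirDeriv hU w').smul sY
    have s2 : ContDiffOn ℝ ∞ (fun q => k q • dirDeriv w' Y q) U := sk.smul (sY.dirDeriv hU w')
    have s3 : ContDiffOn ℝ ∞ (fun q => b • dirDeriv w' k q • Y q) U := contDiffOn_const.smul s1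
    have s4 : ContDiffOn ℝ ∞ (fun q => (-b) • k q • dirDeriv w' Y q) U := contDiffOn_const.smul s2
    have : (fun q => (b * dirDeriv w' k q) • Y q - (b * k q) • dirDeriv w' Y q)
        = fun q => b • dirDeriv w' k q • Y q + (-b) • k q • dirDeriv w' Y q := by
      funext q; module
    rw [this, dirDeriv_add hU s3 s4 hp, dirDeriv_const_smul hU _ s1 hp,
      dirDeriv_const_smul hU _ s2 hp, dirDeriv_smul hU (sk.dirDeriv hU w') sY hp,
      dirDeriv_smul hU sk (sY.dirDeriv hU w') hp]
    module
  rw [dirDeriv_congr hU h.deriv_u hp, dirDeriv_congr hU h.deriv_v hp, ext, ext,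
    h.deriv_u p hp, h.deriv_v p hp, dirDeriv_comm (w := (1, 0)) (z := (0, 1)) hU sY hp,
    dirDeriv_comm (w := (1, 0)) (z := (0, 1)) hU sk hp]
  match_scalars
  · ring
  · linear_combination (-4 * ε * dirDeriv (0, 1) k p) * hr
  · linear_combination (4 * ε * dirDeriv (1, 0) k p) * hr
  · ring

end IsPolarPair

end Polar

/-! ### The canonical lift of a polar surface -/

section Ambient

variable {E F : Type*} [NormedAddCommGroup E] [NormedSpace ℝ E] [NormedAddCommGroup F]
  [NormedSpace ℝ F] [FiniteDimensional ℝ E] [FiniteDimensional ℝ F]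
  {B : LinearMap.BilinForm ℝ E} {C : LinearMap.BilinForm ℝ F} {ε c : ℝ}
  {ι : E →ₗ[ℝ] F} {π : F →ₗ[ℝ] E} {e : F} {U : Set (ℝ × ℝ)} {p w : ℝ × ℝ} {Y ψ : ℝ × ℝ → E}
  {k ρ : ℝ × ℝ → ℝ}

omit [FiniteDimensional ℝ F] in
theorem dirDeriv_cone (hU : IsOpen U) (sψ : ContDiffOn ℝ ∞ ψ U) (sρ : ContDiffOn ℝ ∞ ρ U)
    (hp : p ∈ U) : dirDeriv w (fun q => ρ q • (ι (ψ q) + e)) p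
      = dirDeriv w ρ p • (ι (ψ p) + e) + ρ p • ι (dirDeriv w ψ p) := by
  have s1 := sψ.linearMap ι
  rw [dirDeriv_smul hU sρ (s1.add contDiffOn_const) hp, dirDeriv_add hU s1 contDiffOn_const hp,
    dirDeriv_linearMap ι hU sψ hp, dirDeriv_eq_zero_of_const hU (fun _ _ => rfl) hp, add_zero]

omit [FiniteDimensional ℝ F] in
theorem dirDeriv_dirDeriv_cone (hU : IsOpen U) (sψ : ContDiffOn ℝ ∞ ψ U)
    (sρ : ContDiffOn ℝ ∞ ρ U) (hp : p ∈ U) :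
    dirDeriv w (dirDeriv w (fun q => ρ q • (ι (ψ q) + e))) p
      = dirDeriv w (dirDeriv w ρ) p • (ι (ψ p) + e) + (2 * dirDeriv w ρ p) • ι (dirDeriv w ψ p)
        + ρ p • ι (dirDeriv w (dirDeriv w ψ) p) := by
  have sw := sψ.dirDeriv hU w
  have s1 : ContDiffOn ℝ ∞ (fun q => dirDeriv w ρ q • (ι (ψ q) + e)) U :=
    (sρ.dirDeriv hU w).smul ((sψ.linearMap ι).add contDiffOn_const)
  have s2 : ContDiffOn ℝ ∞ (fun q => ρ q • ι (dirDeriv w ψ q)) U := sρ.smul (sw.linearMap ι)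
  rw [dirDeriv_congr hU (fun q hq => dirDeriv_cone hU sψ sρ hq) hp, dirDeriv_add hU s1 s2 hp,
    dirDeriv_cone hU sψ (sρ.dirDeriv hU w) hp, dirDeriv_smul hU sρ (sw.linearMap ι) hp,
    dirDeriv_linearMap ι hU sw hp]
  module

namespace IsPolarPair

variable (hU : IsOpen U) (hB : ∀ x x' : E, B x x' = B x' x) (hε : ε * ε = 1)
  (h : IsPolarPair B ε c U Y ψ k) (hE : IsConeEmbedding B C c ι π e)
  (sρ : ContDiffOn ℝ ∞ ρ U) (hρ : ∀ p ∈ U, 2 * k p * ρ p = 1)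

include hU hB hε h hE sρ hρ

omit [FiniteDimensional ℝ F] in
-- The scale ρ = 1/(2k) turns the metric entry 2εk² into ε/2.
theorem isPolarLift : IsPolarLift C ε U (1, 0) (0, 1) (-ε) (-1) (fun p => ι (Y p))
    (fun q => ρ q • (ι (ψ q) + e)) := by
  have sY := h.lift.smooth
  have sψ := h.smooth
  have n0 : ∀ p ∈ U, C (ι (ψ p) + e) (ι (ψ p) + e) = 0 := by
    intro p hp
    simp [hE.inner_map, hE.inner_e_left, hE.inner_e_right, hE.inner_e, h.length p hp]
  have nu : ∀ p ∈ U, B (ψ p) (dirDeriv (1, 0) ψ p) = 0 := by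
    intro p hp
    simp [h.deriv_u p hp, (h.normal p hp).oy, (h.normal p hp).oz]
  have nv : ∀ p ∈ U, B (ψ p) (dirDeriv (0, 1) ψ p) = 0 := by
    intro p hp
    simp [h.deriv_v p hp, (h.normal p hp).oy, (h.normal p hp).ow]
  refine ⟨⟨sρ.smul ((sψ.linearMap ι).add contDiffOn_const), ?_, ?_, ?_, ?_⟩, sY.linearMap ι,
    ?_, ?_, ?_⟩ <;> intro p hp
  · simp only [map_smul, LinearMap.smul_apply, n0 p hp, smul_zero]
  · rw [dirDeriv_cone hU sψ sρ hp]
    simp only [map_add, map_smul, LinearMap.add_apply, LinearMap.smul_apply, smul_eq_mul,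
      hE.inner_map, hE.inner_e_left, hE.inner_e_right, hE.inner_e, h.length p hp,
      nu p hp, hB _ (ψ p), h.inner_u_u hU hB hp]
    ring
  · rw [dirDeriv_cone hU sψ sρ hp]
    simp only [map_add, map_smul, LinearMap.add_apply, LinearMap.smul_apply, smul_eq_mul,
      hE.inner_map, hE.inner_e_left, hE.inner_e_right, hE.inner_e, h.length p hp,
      nv p hp, hB _ (ψ p), h.inner_v_v hU hB hp]
    ring
  · rw [dirDeriv_cone hU sψ sρ hp, dirDeriv_cone hU sψ sρ hp]
    simp only [map_add, map_smul, LinearMap.add_apply, LinearMap.smul_apply, smul_eq_mul,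
      hE.inner_map, hE.inner_e_left, hE.inner_e_right, hE.inner_e, h.length p hp,
      nu p hp, nv p hp, hB _ (ψ p), h.inner_u_v hU hB hp]
    linear_combination (ε / 2 * (2 * k p * ρ p + 1)) * hρ p hp
  · simp only [map_add, map_smul, LinearMap.add_apply, LinearMap.smul_apply, hE.inner_map,
      hE.inner_e_left, (h.normal p hp).oy, add_zero, smul_zero]
  -- Solving the formula for ψ_u gives Y_v = 2ρk_v Y - ερψ_u, and ρψ_u is X_u - 2kρ_u X; this is
  -- where the factor -ε comes from. The formula for ψ_v gives -1 in the same way.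
  · refine ⟨2 * ρ p * dirDeriv (0, 1) k p, 2 * k p * ε * dirDeriv (1, 0) ρ p, ?_⟩
    rw [dirDeriv_linearMap ι hU sY hp, dirDeriv_cone hU sψ sρ hp, h.deriv_u p hp, map_sub,
      map_smul, map_smul]
    match_scalars
    · linear_combination (- (ε * ε)) * hρ p hp - hε
    · linear_combination (2 * ρ p * dirDeriv (0, 1) k p) * hε
    · linear_combination (- ε * dirDeriv (1, 0) ρ p) * hρ p hp
    · linear_combination (- ε * dirDeriv (1, 0) ρ p) * hρ p hp
  · refine ⟨2 * ρ p * dirDeriv (1, 0) k p, 2 * k p * dirDeriv (0, 1) ρ p, ?_⟩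
    rw [dirDeriv_linearMap ι hU sY hp, dirDeriv_cone hU sψ sρ hp, h.deriv_v p hp, map_sub,
      map_smul, map_smul]
    match_scalars
    · linear_combination - hρ p hp
    · ring
    · linear_combination (- dirDeriv (0, 1) ρ p) * hρ p hp
    · linear_combination (- dirDeriv (0, 1) ρ p) * hρ p hp

omit [FiniteDimensional ℝ F] hB hE hε in
-- This is `deriv_uu_sub` multiplied by ρ, together with the derivatives of ρ.
theorem dirDeriv_uu_cone (hp : p ∈ U) : ∃ a b b' : ℝ,
    dirDeriv (1, 0) (dirDeriv (1, 0) (fun q => ρ q • (ι (ψ q) + e))) p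
      = ε • dirDeriv (0, 1) (dirDeriv (0, 1) (fun q => ρ q • (ι (ψ q) + e))) p
        + a • (ρ p • (ι (ψ p) + e)) + b • dirDeriv (1, 0) (fun q => ρ q • (ι (ψ q) + e)) p
        + b' • dirDeriv (0, 1) (fun q => ρ q • (ι (ψ q) + e)) p := by
  have sψ := h.smooth
  have r := hρ p hp
  -- The witnesses result from substituting ψ + e = 2k X and ψ_u = 2k (X_u - ρ_u (ψ + e)), and the
  -- same in v. Differentiating 2kρ = 1 would show that the last two vanish, but membership in the
  -- span is enough.
  refine ⟨2 * k p * (dirDeriv (1, 0) (dirDeriv (1, 0) ρ) p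
      - ε * dirDeriv (0, 1) (dirDeriv (0, 1) ρ) p)
      - 2 * k p * (2 * k p * (2 * dirDeriv (1, 0) ρ p + 4 * ρ p * ρ p * dirDeriv (1, 0) k p))
        * dirDeriv (1, 0) ρ p
      + 2 * k p * (2 * k p * ε * (2 * dirDeriv (0, 1) ρ p + 4 * ρ p * ρ p * dirDeriv (0, 1) k p))
        * dirDeriv (0, 1) ρ p,
    2 * k p * (2 * dirDeriv (1, 0) ρ p + 4 * ρ p * ρ p * dirDeriv (1, 0) k p),
    - (2 * k p * ε * (2 * dirDeriv (0, 1) ρ p + 4 * ρ p * ρ p * dirDeriv (0, 1) k p)), ?_⟩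
  rw [dirDeriv_dirDeriv_cone hU sψ sρ hp, dirDeriv_dirDeriv_cone hU sψ sρ hp,
    dirDeriv_cone hU sψ sρ hp, dirDeriv_cone hU sψ sρ hp, h.deriv_uu_sub hU hp r, map_sub,
    map_add, map_smul, map_smul, map_smul]
  generalize ι (ψ p) + e = Ψ
  match_scalars
  · linear_combination (- dirDeriv (1, 0) (dirDeriv (1, 0) ρ) p
      + ε * dirDeriv (0, 1) (dirDeriv (0, 1) ρ) p
      + 2 * k p * (2 * dirDeriv (1, 0) ρ p + 4 * ρ p * ρ p * dirDeriv (1, 0) k p)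
        * dirDeriv (1, 0) ρ p
      - 2 * k p * ε * (2 * dirDeriv (0, 1) ρ p + 4 * ρ p * ρ p * dirDeriv (0, 1) k p)
        * dirDeriv (0, 1) ρ p) * r
  · linear_combination (- (2 * dirDeriv (1, 0) ρ p + 4 * ρ p * ρ p * dirDeriv (1, 0) k p)) * r
  · ring
  · linear_combination (ε * (2 * dirDeriv (0, 1) ρ p + 4 * ρ p * ρ p * dirDeriv (0, 1) k p)) * r

end IsPolarPair

/-- The spectral transform of a polar surface in its quadric, embedded into a light cone. -/
theorem IsPolarPair.isSpectralTransformOfLifts [Nontrivial F] (hU : IsOpen U)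
    (hB : ∀ x x' : E, B x x' = B x' x) (hε : ε * ε = 1) (h : IsPolarPair B ε c U Y ψ k)
    (hE : IsConeEmbedding B C c ι π e) (hk : ∀ p ∈ U, k p ≠ 0) {t : ℝ} {Y' : ℝ × ℝ → E}
    {T : ℝ × ℝ → E →ₗ[ℝ] E} (sY' : ContDiffOn ℝ ∞ Y' U)
    (hT : IsGauge B U (1, 0) (0, 1) t (ε * t) Y Y' T) {X X' : ℝ × ℝ → F}
    (hX : ∀ p ∈ U, X p = ι (ψ p) + e) (hX' : ∀ p ∈ U, X' p = ι (T p (ψ p)) + e) :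
    IsSpectralTransformOfLifts C ε ε t U X X' := by
  have hTF := hE.isGauge hU h.lift.smooth sY' hT
  have sρ : ContDiffOn ℝ ∞ (fun p => (2 * k p)⁻¹) U :=
    (contDiffOn_const.mul h.smooth_k).inv fun p hp => mul_ne_zero two_ne_zero (hk p hp)
  have hρ : ∀ p ∈ U, 2 * k p * (2 * k p)⁻¹ = 1 := fun p hp =>
    mul_inv_cancel₀ (mul_ne_zero two_ne_zero (hk p hp))
  have hρ0 : ∀ p ∈ U, (2 * k p)⁻¹ ≠ 0 := fun p hp =>
    inv_ne_zero (mul_ne_zero two_ne_zero (hk p hp))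
  -- Pairing X with κ₂ gives k ≠ 0; this covers c = 0, where e does not help.
  have hX0 : ∀ p ∈ U, X p ≠ 0 := by
    intro p hp e0
    apply hk p hp
    rw [hX p hp] at e0
    have e1 := congrArg (fun x => C x (ι (hopfV B 1 Y p))) e0
    simpa [hE.inner_map, hE.inner_e_left, h.k_eq p hp] using e1
  have ext : ∀ p ∈ U, extendMap ι π (T p) (X p) = X' p := by
    intro p hp
    rw [hX p hp, hX' p hp, map_add, hE.extendMap_ι, hE.extendMap_e]
  have hX0' : ∀ p ∈ U, X' p ≠ 0 := by
    intro p hp e0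
    rw [← ext p hp] at e0
    exact hX0 p hp (hTF.inj p hp (by rw [e0, map_zero]))
  obtain ⟨q, hq⟩ := exists_isLift hX0
  obtain ⟨q', hq'⟩ := exists_isLift hX0'
  refine ⟨q, q', hq, hq', ?_⟩
  refine (h.isPolarLift hU hB hε hE sρ hρ).isSpectralTransform hU hE.symm hε hTF
    (fun p hp => h.dirDeriv_uu_cone hU sρ hρ hp)
    (hq.smul_left hρ0 fun p hp => by rw [hX p hp])
    (hq'.smul_left hρ0 fun p hp => ?_)
  rw [map_smul, ← hX p hp, ext p hp]

end Ambient

/-! ### The scalar products `ℝ^m_s` -/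

section PseudoForm

theorem pseudoForm_apply (m s : ℕ) (x y : Fin m → ℝ) : pseudoForm m s x y
    = ∑ i : Fin m, (if i.val + s < m then (1 : ℝ) else -1) * (x i * y i) := rfl

theorem pseudoForm_symm (m s : ℕ) (x y : Fin m → ℝ) : pseudoForm m s x y = pseudoForm m s y x := by
  simp only [pseudoForm_apply, mul_comm (x _)]

/-- The embedding `x ↦ (x, 0)`. -/
def snocZero (m : ℕ) : (Fin m → ℝ) →ₗ[ℝ] (Fin (m + 1) → ℝ) where
  toFun x := Fin.snoc (α := fun _ => ℝ) x 0
  map_add' x y := by ext i; refine Fin.lastCases ?_ (fun j => ?_) i <;> simp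
  map_smul' a x := by ext i; refine Fin.lastCases ?_ (fun j => ?_) i <;> simp

/-- The embedding `x ↦ (0, x)`. -/
def consZero (m : ℕ) : (Fin m → ℝ) →ₗ[ℝ] (Fin (m + 1) → ℝ) where
  toFun x := Fin.cons (α := fun _ => ℝ) 0 x
  map_add' x y := by ext i; refine Fin.cases ?_ (fun j => ?_) i <;> simp
  map_smul' a x := by ext i; refine Fin.cases ?_ (fun j => ?_) i <;> simp

theorem isConeEmbedding_id (m s : ℕ) : IsConeEmbedding (pseudoForm m s) (pseudoForm m s) 0
    LinearMap.id LinearMap.id 0 :=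
  ⟨pseudoForm_symm m s, fun _ => rfl, fun _ _ => rfl, rfl, by simp⟩

/-- Raising m and s together keeps the old signs and makes the appended last coordinate negative, so
⟨e, e⟩ = -c. -/
theorem isConeEmbedding_snoc (m s : ℕ) {c : ℝ} (hc : 0 < c) :
    IsConeEmbedding (pseudoForm m s) (pseudoForm (m + 1) (s + 1)) c (snocZero m)
      (LinearMap.funLeft ℝ ℝ Fin.castSucc)
      (Fin.snoc (α := fun _ => ℝ) (0 : Fin m → ℝ) (Real.sqrt c)) := by
  refine ⟨pseudoForm_symm _ _, ?_, ?_, ?_, ?_⟩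
  · intro x; ext i; simp [snocZero, LinearMap.funLeft_apply]
  · intro x y
    rw [pseudoForm_apply, pseudoForm_apply, Fin.sum_univ_castSucc]
    simp [snocZero, LinearMap.funLeft_apply, ← add_assoc]
  · ext i; simp [LinearMap.funLeft_apply]
  · rw [pseudoForm_apply, Fin.sum_univ_castSucc]
    simp [Real.mul_self_sqrt hc.le]

theorem isConeEmbedding_cons (m s : ℕ) (hs : s ≤ m) {c : ℝ} (hc : c < 0) :
    IsConeEmbedding (pseudoForm m s) (pseudoForm (m + 1) s) c (consZero m)
      (LinearMap.funLeft ℝ ℝ Fin.succ)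
      (Fin.cons (α := fun _ => ℝ) (Real.sqrt (-c)) (0 : Fin m → ℝ)) := by
  -- Prepending shifts every index by one, so the old signs persist; the new coordinate 0 is
  -- positive because s ≤ m.
  have h1 : ∀ i : ℕ, i + 1 + s < m + 1 ↔ i + s < m := fun i => by omega
  refine ⟨pseudoForm_symm _ _, ?_, ?_, ?_, ?_⟩
  · intro x; ext i; simp [consZero, LinearMap.funLeft_apply]
  · intro x y
    rw [pseudoForm_apply, pseudoForm_apply, Fin.sum_univ_succ]
    simp [consZero, LinearMap.funLeft_apply, h1]
  · ext i; simp [LinearMap.funLeft_apply]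
  · rw [pseudoForm_apply, Fin.sum_univ_succ]
    simp [Real.mul_self_sqrt (neg_nonneg.2 hc.le), Nat.lt_succ_of_le hs]

end PseudoForm

/-! ### The permutability theorem -/

theorem theorem5p2 (n r : ℕ) (hr : 1 ≤ r) (hn : r + 2 ≤ n)
    (ε : ℝ) (hε : ε = 1 ∨ ε = -1) (ctilde c : ℝ)
    (U : Set (ℝ × ℝ)) (hU : IsOpen U)
    (y y' : ℝ × ℝ → Projectivization ℝ (Fin (n + 2) → ℝ))
    (hspec : IsSpectralTransform (pseudoForm (n + 2) (r + 1)) 1 ε ctilde U y y')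
    (ψ : ℝ × ℝ → Fin (n + 2) → ℝ)
    (hψ : IsPolar (pseudoForm (n + 2) (r + 1)) U c y ψ)
    (hnd : IsNondegenerate (pseudoForm (n + 2) (r + 1)) U ψ) :
    ∃ ψ' : ℝ × ℝ → Fin (n + 2) → ℝ,
      IsPolar (pseudoForm (n + 2) (r + 1)) U c y' ψ' ∧
      IsQuadricSpectralTransform (n + 2) (r + 1) c ε ε ctilde
        (regularSet (pseudoForm (n + 2) (r + 1)) U ψ) ψ ψ' := by
  have hε2 : ε * ε = 1 := by rcases hε with rfl | rfl <;> norm_num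
  have hB := pseudoForm_symm (n + 2) (r + 1)
  obtain ⟨Y, Y', hY, hY', hiso, -, su, sv, τ, hτ, hu, hv⟩ := hspec
  obtain ⟨Z, hZ, hsec, hDu, hDv, hlen⟩ := hψ
  -- The polar surface comes with its own canonical lift Z, and the spectral transform with Y; the
  -- bundle and its connection do not depend on this choice.
  have hcongr := fun p (hp : p ∈ U) => hY.normalProj_congr hU hB hZ hp
  have hsecY : IsNormalSection (pseudoForm (n + 2) (r + 1)) Y U ψ :=
    ⟨hsec.1, fun p hp => by rw [← (hcongr p hp).1]; exact hsec.2 p hp⟩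
  have hDu' : ∀ p ∈ U, normalDU (pseudoForm (n + 2) (r + 1)) 1 Y ψ p = 0 := fun p hp => by
    rw [normalDU, ← (hcongr p hp).2]; exact hDu p hp
  have hDv' : ∀ p ∈ U, normalDV (pseudoForm (n + 2) (r + 1)) 1 Y ψ p = 0 := fun p hp => by
    rw [normalDV, ← (hcongr p hp).2]; exact hDv p hp
  have hnorm : ∀ p ∈ U, IsFrameNormal (pseudoForm (n + 2) (r + 1)) 1 (1, 0) (0, 1) Y p (ψ p) :=
    fun p hp => (mem_confNormal_iff hB (one_mul 1)).1 (hsecY.2 p hp)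
  have hpair := hY.isNullLift.isPolarPair hU hB hiso hsec.1 hnorm hDu' hDv' hlen
  have hT := hτ.isGauge hU hB hY.isNullLift hY'.isNullLift hu hv su sv
  refine ⟨fun p => τ p (ψ p), ⟨Y', hY', ⟨hτ.smooth U hU le_rfl ψ hsecY,
    fun p hp => (hτ.bij p hp).mapsTo (hsecY.2 p hp)⟩, ?_, ?_, ?_⟩, ?_⟩
  · intro p hp
    rw [hτ.connU U hU le_rfl ψ hsecY p hp, hDu' p hp, map_zero]
  · intro p hp
    rw [hτ.connV U hU le_rfl ψ hsecY p hp, hDv' p hp, map_zero]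
  · intro p hp
    rw [hτ.isometric p hp _ (hsecY.2 p hp) _ (hsecY.2 p hp), hlen p hp]
  have hreg := hpair.regularSet_eq hU hB hε2
  set W := regularSet (pseudoForm (n + 2) (r + 1)) U ψ
  have hWU : W ⊆ U := fun p hp => hp.1
  -- M_0 is the set where the smooth function k does not vanish.
  have hW : IsOpen W := by
    rw [hreg]
    exact hpair.smooth_k.continuousOn.isOpen_inter_preimage hU isOpen_ne
  have hk : ∀ p ∈ W, pseudoForm (n + 2) (r + 1) (ψ p)
      (hopfV (pseudoForm (n + 2) (r + 1)) 1 Y p) ≠ 0 := fun p hp => by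
    rw [hreg] at hp; exact hp.2
  have hTψ : ∀ p ∈ W, gaugeMap (pseudoForm (n + 2) (r + 1)) (1, 0) (0, 1) Y Y' τ p (ψ p)
      = τ p (ψ p) := fun p hp => gaugeMap_of_normal (hnorm p (hWU hp))
  -- The ambient space and the cone embedding are left free, so that the three signs of c differ
  -- only in the embedding.
  have main := fun {F : Type} [NormedAddCommGroup F] [NormedSpace ℝ F] [FiniteDimensional ℝ F]
      [Nontrivial F] {C : LinearMap.BilinForm ℝ F} {ι π e} {X X' : ℝ × ℝ → F}
      (hE : IsConeEmbedding (pseudoForm (n + 2) (r + 1)) C c ι π e) =>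
    (hpair.mono hWU).isSpectralTransformOfLifts (X := X) (X' := X') hW hB hε2 hE hk
      (hY'.smooth.mono hWU) (hT.mono hWU)
  refine ⟨?_, ?_, ?_⟩
  · rintro rfl
    refine main (isConeEmbedding_id _ _) (fun p hp => ?_) (fun p hp => ?_)
    · simp
    · simp [hTψ p hp]
  · intro hc
    refine main (isConeEmbedding_snoc _ _ hc) (fun p hp => ?_) (fun p hp => ?_)
    · ext i; refine Fin.lastCases ?_ (fun j => ?_) i <;> simp [snocZero]
    · ext i; refine Fin.lastCases ?_ (fun j => ?_) i <;> simp [snocZero, hTψ p hp]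
  · intro hc
    refine main (isConeEmbedding_cons _ _ (by omega) hc) (fun p hp => ?_) (fun p hp => ?_)
    · ext i; refine Fin.cases ?_ (fun j => ?_) i <;> simp [consZero]
    · ext i; refine Fin.cases ?_ (fun j => ?_) i <;> simp [consZero, hTψ p hp]
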